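/- Let $\Bbbk$ be an algebraically closed field of arbitrary characteristic, let $V=\Bbbk^{N+1}$, and let $\mathbb{G}(m,\mathbb{P}^N)$ be the Grassmann variety of $m$-planes in $\mathbb{P}^N$, i.e. of $(m+1)$-dimensional linear subspaces $L\subset V$; its tangent space at $[L]$ is $\operatorname{Hom}(L,V/L)$. For a variety $Z$ and a rational map $f: Z \dashrightarrow \mathbb{G}(n,\mathbb{P}^N)$, whose value at a general point $z$ is a linear subspace $f(z)\subset V$, the differential $d_zf: T_zZ\to \operatorname{Hom}(f(z),V/f(z))$ corresponds to a linear map $\Phi_{f,z}: f(z)\to \operatorname{Hom}(T_zZ, V/f(z))$, $v \mapsto (t\mapsto d_zf(t)(v))$. The *shrinking map* of $Z$ with respect to $f$ is the rational map $\sigma_{Z,f}: Z\dashrightarrow \mathbb{G}(n^-,\mathbb{P}^N)$ sending a general point $z\in Z$ to $\ker \Phi_{f,z}\subset f(z)\subset V$, where $n^-+1$ is the dimension of this kernel for general $z$. Let $X\subset\mathbb{P}^N$ be a projective variety of dimension $n$, and let $\gamma: X\dashrightarrow \mathbb{G}(n,\mathbb{P}^N)$ be its Gauss map, which sends a smooth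 point $x$ to the embedded tangent space $\mathbb{T}_xX\subset\mathbb{P}^N$. The *degeneracy map* $\kappa$ of $X$ is the rational map from $X$ to a Grassmann variety sending a general point $x\in X$ to the linear subvariety of $\mathbb{T}_xX$ through $x$ which corresponds to $\ker(d_x\gamma)\subset T_xX$ under the one-to-one correspondence between the $l$-planes in $\mathbb{T}_xX$ containing $x$ and the $l$-dimensional vector subspaces of $T_xX$. Let $X'\subset \mathbb{G}(n,\mathbb{P}^N)\times\mathbb{P}^N$ be the graph of $\gamma$, i.e. the closure of $\{(\gamma(x),x) : x\in X \text{ smooth}\}$, and let $\mathrm{pr}_1: X'\to\mathbb{G}(n,\mathbb{P}^N)$ be the first projection. Then the following three are rational maps from $X$ to one and the same Grassmann variety $\mathbb{G}(n^-,\mathbb{P}^N)$, and they coincide: 1. the degeneracy map $\kappa$ of $X$; 2. the shrinking map $\sigma_{X,\gamma}$ of $X$ with respect to $\gamma$; 3. the composite $\sigma_{X',\mathrm{pr}_1}\circ(\gamma,\mathrm{id}_X)$, where $\sigma_{X',\mathrm{pr}_1}$ is the shrinking map of $X'$ with respect to $\mathrm{pr}_1$. -/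

import Mathlib

open scoped LinearAlgebra.Projectivization Topology

noncomputable section

namespace GaussShrink

/-! ### Zariski topology and regular functions through homogeneous coordinates -/

/-- Homogeneous coordinates on a set `A`: points of `A` are represented by points of a subset
`cone` of an affine space, with quotient map `proj`.  Only the instances below are used
(projective space, Grassmannians, and products), for which `cone → A` is a locally trivial
principal bundle, so that the Zariski topology and the regular functions of `A` are the quotient
ones. -/
structure HomCoords (k : Type*) (A : Type*) where
  idx : Type
  cone : Set (idx → k)
  proj : cone → A

/-- The ambient vector space `k ^ (N + 1)` whose lines are the points of `ℙ ^ N`. -/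
abbrev Vec (k : Type*) (N : ℕ) : Type _ := Fin (N + 1) → k

/-- The set of `m`-dimensional linear subspaces of `k ^ (N + 1)`: the Grassmann variety of
`(m - 1)`-planes in `ℙ ^ N`. -/
abbrev Gr (k : Type*) [Field k] (N m : ℕ) : Type _ :=
  {L : Submodule k (Vec k N) // Module.finrank k L = m}

variable {k : Type*} [Field k] {A B : Type*} {N : ℕ}

/-- Homogeneous coordinates on `ℙ ^ N`. -/
def projCoords (k : Type*) [Field k] (N : ℕ) : HomCoords k (ℙ k (Vec k N)) where
  idx := Fin (N + 1)
  cone := {v | v ≠ 0}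
  proj v := Projectivization.mk k v.1 v.2

/-- Stiefel coordinates on the Grassmannian: a linear subspace is represented by the matrix whose
rows form a basis of it. -/
def grCoords (k : Type*) [Field k] (N m : ℕ) : HomCoords k (Gr k N m) where
  idx := Fin m × Fin (N + 1)
  cone := {p | LinearIndependent k fun (i : Fin m) (j : Fin (N + 1)) => p (i, j)}
  proj p := ⟨Submodule.span k (Set.range fun (i : Fin m) (j : Fin (N + 1)) => p.1 (i, j)), by
    simpa using finrank_span_eq_card p.2⟩

/-- Coordinates on a product. -/
def HomCoords.prod (M : HomCoords k A) (M' : HomCoords k B) : HomCoords k (A × B) where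
  idx := M.idx ⊕ M'.idx
  cone := {p | (fun i => p (Sum.inl i)) ∈ M.cone ∧ (fun i => p (Sum.inr i)) ∈ M'.cone}
  proj p := (M.proj ⟨_, p.2.1⟩, M'.proj ⟨_, p.2.2⟩)

/-- The Zariski topology: the closed subsets of `A` are those whose preimage in the cone is the
zero locus of a set of polynomials. -/
abbrev HomCoords.zariski (M : HomCoords k A) : TopologicalSpace A :=
  TopologicalSpace.coinduced M.proj
    (TopologicalSpace.induced
      (fun p : M.cone => (MvPolynomial.pointToPoint p.1 : PrimeSpectrum (MvPolynomial M.idx k)))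
      inferInstance)

/-- `φ` is a regular function on `Z` near `z`: in coordinates, locally on `Z`, it is a quotient
of two polynomials.  (The values of `φ` outside `Z` do not matter.) -/
def IsRegularFun (M : HomCoords k A) (Z : Set A) (z : A) (φ : A → k) : Prop :=
  ∀ p : M.cone, M.proj p = z → ∃ g h : MvPolynomial M.idx k, MvPolynomial.eval p.1 h ≠ 0 ∧
    ∀ q : M.cone, M.proj q ∈ Z → MvPolynomial.eval q.1 h ≠ 0 →
      φ (M.proj q) = MvPolynomial.eval q.1 g / MvPolynomial.eval q.1 h

/-- The algebra of functions that are regular on `Z` near `z`; its quotient by the functions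
vanishing on `Z` near `z` is the local ring of `Z` at `z`. -/
def localFun (M : HomCoords k A) (Z : Set A) (z : A) : Subalgebra k (A → k) where
  carrier := {φ | IsRegularFun M Z z φ}
  mul_mem' := by
    intro φ ψ hφ hψ p hp
    obtain ⟨g, h, hh, H⟩ := hφ p hp
    obtain ⟨g', h', hh', H'⟩ := hψ p hp
    refine ⟨g * g', h * h', by simpa using ⟨hh, hh'⟩, fun q hq hne => ?_⟩
    rw [map_mul] at hne
    rw [Pi.mul_apply, H q hq (left_ne_zero_of_mul hne), H' q hq (right_ne_zero_of_mul hne),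
      map_mul, map_mul, div_mul_div_comm]
  add_mem' := by
    intro φ ψ hφ hψ p hp
    obtain ⟨g, h, hh, H⟩ := hφ p hp
    obtain ⟨g', h', hh', H'⟩ := hψ p hp
    refine ⟨g * h' + h * g', h * h', by simpa using ⟨hh, hh'⟩, fun q hq hne => ?_⟩
    rw [map_mul] at hne
    rw [Pi.add_apply, H q hq (left_ne_zero_of_mul hne), H' q hq (right_ne_zero_of_mul hne),
      div_add_div _ _ (left_ne_zero_of_mul hne) (right_ne_zero_of_mul hne)]
    simp
  algebraMap_mem' := by
    intro c p _
    exact ⟨MvPolynomial.C c, 1, by simp, fun q _ _ => by simp⟩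

/-- The Zariski tangent space of `Z` at `z`: the `k`-linear derivations of the local ring at `z`
with values in the residue field `k`.  (A derivation automatically kills the functions that vanish
on `Z` near `z`.) -/
def tangentSpace (M : HomCoords k A) (Z : Set A) (z : A) :
    Submodule k (localFun M Z z →ₗ[k] k) where
  carrier := {t | ∀ φ ψ : localFun M Z z, t (φ * ψ) = φ.1 z * t ψ + ψ.1 z * t φ}
  zero_mem' := by intro φ ψ; simp
  add_mem' := by
    intro s t hs ht φ ψ
    rw [LinearMap.add_apply, hs φ ψ, ht φ ψ, LinearMap.add_apply, LinearMap.add_apply]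
    ring
  smul_mem' := by
    intro c t ht φ ψ
    rw [LinearMap.smul_apply, ht φ ψ, LinearMap.smul_apply, LinearMap.smul_apply,
      smul_eq_mul, smul_eq_mul, smul_eq_mul]
    ring

/-! ### Rational maps to Grassmann varieties and their differentials -/

/-- `e` is a local frame of `f` on `Z` near `z`: regular vector-valued functions which form a basis
of the linear subspace `f y` for all `y ∈ Z` near `z`. -/
structure IsFrameAt (M : HomCoords k A) (Z : Set A) (f : A → Submodule k (Vec k N)) (z : A)
    {m : ℕ} (e : Fin m → A → Vec k N) : Prop where
  regular : ∀ i j, (fun a => e i a j) ∈ localFun M Z z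
  basis : ∃ U : Set A, IsOpen[M.zariski] U ∧ z ∈ U ∧ ∀ y ∈ Z ∩ U,
    LinearIndependent k (fun i => e i y) ∧ Submodule.span k (Set.range fun i => e i y) = f y

/-- On `Z` near `z ∈ Z`, the map `f` is a morphism to the Grassmann variety of `m`-dimensional
subspaces; by the universal property of the Grassmann variety this means that the subspaces `f y`
form a subbundle of rank `m` of the trivial bundle, i.e. that they have a regular frame. -/
def IsMorphismAt (M : HomCoords k A) (Z : Set A) (m : ℕ) (f : A → Submodule k (Vec k N))
    (z : A) : Prop :=
  z ∈ Z ∧ ∃ e : Fin m → A → Vec k N, IsFrameAt M Z f z e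

/-- `P` holds at a general point of `Z`, i.e. on a dense open subset of `Z`. -/
def Generically (M : HomCoords k A) (Z : Set A) (P : A → Prop) : Prop :=
  ∃ U : Set A, IsOpen[M.zariski] U ∧ Z ⊆ closure[M.zariski] (Z ∩ U) ∧ ∀ z ∈ Z ∩ U, P z

/-- `f` defines a rational map from `Z` to the Grassmann variety of `m`-dimensional subspaces. -/
def IsRationalMap (M : HomCoords k A) (Z : Set A) (m : ℕ) (f : A → Submodule k (Vec k N)) :
    Prop :=
  Generically M Z (IsMorphismAt M Z m f)

/-- The differential at `z` of a map `f` to a Grassmann variety, computed in a frame `e`; the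
tangent space of the Grassmann variety at `[L]` is `Hom(L, V / L)`, and the tangent vector `t` is
sent to the homomorphism `e i z ↦ t (e i) mod f z`. -/
def frameDifferential (M : HomCoords k A) (Z : Set A) (f : A → Submodule k (Vec k N)) (z : A)
    {m : ℕ} (e : Fin m → A → Vec k N) (hz : z ∈ Z) (he : IsFrameAt M Z f z e) :
    tangentSpace M Z z →ₗ[k] (f z →ₗ[k] (Vec k N ⧸ f z)) :=
  have h : LinearIndependent k (fun i => e i z) ∧
      Submodule.span k (Set.range fun i => e i z) = f z :=
    let ⟨_, _, hU, H⟩ := he.basis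
    H z ⟨hz, hU⟩
  (((Module.Basis.span h.1).map (LinearEquiv.ofEq _ _ h.2)).constr k).toLinearMap ∘ₗ
    LinearMap.pi fun i => (f z).mkQ ∘ₗ LinearMap.pi fun j =>
      (LinearMap.applyₗ (⟨fun a => e i a j, he.regular i j⟩ : localFun M Z z)) ∘ₗ
        (tangentSpace M Z z).subtype

open Classical in
/-- The differential `d_z f : T_z Z → Hom(f z, V / f z)` of a map `f` from `Z` to a Grassmann
variety that is a morphism near `z` (it does not depend on the frame); `0` otherwise. -/
def differential (M : HomCoords k A) (Z : Set A) (f : A → Submodule k (Vec k N)) (z : A) :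
    tangentSpace M Z z →ₗ[k] (f z →ₗ[k] (Vec k N ⧸ f z)) :=
  if h : ∃ m : ℕ, IsMorphismAt M Z m f z then
    frameDifferential M Z f z h.choose_spec.2.choose h.choose_spec.1 h.choose_spec.2.choose_spec
  else 0

/-- The homomorphism `Φ_f` at `z`, which corresponds to the differential under the identification
`Hom(f z, Hom(T_z Z, V / f z)) = Hom(T_z Z, Hom(f z, V / f z))`. -/
def shrinkingHom (M : HomCoords k A) (Z : Set A) (f : A → Submodule k (Vec k N)) (z : A) :
    f z →ₗ[k] (tangentSpace M Z z →ₗ[k] (Vec k N ⧸ f z)) :=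
  (differential M Z f z).flip

/-- The shrinking map `σ_{Z, f}`, sending a general `z` to `ker Φ_f ⊆ f z ⊆ V`. -/
def shrinkingMap (M : HomCoords k A) (Z : Set A) (f : A → Submodule k (Vec k N)) (z : A) :
    Submodule k (Vec k N) :=
  (LinearMap.ker (shrinkingHom M Z f z)).map (f z).subtype

/-! ### Projective varieties and Gauss maps -/

/-- A projective variety: a Zariski closed irreducible subset of `ℙ ^ N`. -/
def IsProjectiveVariety (X : Set (ℙ k (Vec k N))) : Prop :=
  IsClosed[(projCoords k N).zariski] X ∧ @IsIrreducible _ (projCoords k N).zariski X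

/-- The homogeneous ideal of `X`. -/
def homIdeal (X : Set (ℙ k (Vec k N))) : Ideal (MvPolynomial (Fin (N + 1)) k) :=
  MvPolynomial.vanishingIdeal k {v | ∃ hv : v ≠ 0, Projectivization.mk k v hv ∈ X}

/-- The projective variety `X` has dimension `n`: its homogeneous coordinate ring has
transcendence degree `n + 1`. -/
def HasDim (X : Set (ℙ k (Vec k N))) (n : ℕ) : Prop :=
  Algebra.trdeg k (MvPolynomial (Fin (N + 1)) k ⧸ homIdeal X) = ((n + 1 : ℕ) : Cardinal)

/-- The embedded tangent space of `X` at `x`, as a linear subspace of `k ^ (N + 1)`: the common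
zeros of the linear forms `∑ i, ∂F/∂x_i (x) w_i`, for `F` in the ideal of `X`.  As a function
of `x` this is the Gauss map of `X`, as a rational map defined at the smooth points. -/
def embTangentSpace (X : Set (ℙ k (Vec k N))) (x : ℙ k (Vec k N)) : Submodule k (Vec k N) :=
  ⨅ F ∈ homIdeal X, LinearMap.ker
    (∑ i, MvPolynomial.eval x.rep (MvPolynomial.pderiv i F) •
      (LinearMap.proj i : Vec k N →ₗ[k] k))

/-- `x` is a smooth point of the `n`-dimensional variety `X`. -/
def IsSmoothPoint (X : Set (ℙ k (Vec k N))) (n : ℕ) (x : ℙ k (Vec k N)) : Prop :=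
  x ∈ X ∧ Module.finrank k (embTangentSpace X x) = n + 1

/-- The graph of the Gauss map of `X`: the closure of the set of the pairs `(T_x X, x)`, where
`x` is a smooth point of `X` and `T_x X` is the embedded tangent space. -/
def gaussGraph (X : Set (ℙ k (Vec k N))) (n : ℕ) : Set (Gr k N (n + 1) × ℙ k (Vec k N)) :=
  closure[((grCoords k N (n + 1)).prod (projCoords k N)).zariski]
    {y | IsSmoothPoint X n y.2 ∧ y.1.1 = embTangentSpace X y.2}

/-- The linear subspace through `x` that corresponds to a subspace `K ⊆ T_x X`.  By the
differential of the inclusion `X → ℙ ^ N` at `x`, a tangent vector `t` becomes a homomorphism from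
the line `x` to `V / x`; the images of these, for `t ∈ K`, span the subspace modulo the line `x`. -/
def linearSpan (X : Set (ℙ k (Vec k N))) (x : ℙ k (Vec k N))
    (K : Submodule k (tangentSpace (projCoords k N) X x)) : Submodule k (Vec k N) :=
  (⨆ t ∈ K, LinearMap.range
    (differential (projCoords k N) X Projectivization.submodule x t)).comap x.submodule.mkQ

/-- The degeneracy map `κ` of `X`, sending a general `x` to the linear space that corresponds to
the kernel of the differential of the Gauss map at `x`. -/
def degeneracyMap (X : Set (ℙ k (Vec k N))) (x : ℙ k (Vec k N)) : Submodule k (Vec k N) :=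
  linearSpan X x (LinearMap.ker (differential (projCoords k N) X (embTangentSpace X) x))

end GaussShrink

end

open scoped LinearAlgebra.Projectivization Topology
open GaussShrink

universe u

noncomputable section

namespace GaussShrink

/-! At a smooth point the degeneracy map and the shrinking map of the Gauss map are both the radical
of the second fundamental form. Represent `x` by a vector `q` with `q i₀ = 1`. A tangent vector `t`
becomes a vector `τ` in the embedded tangent space `T` with `τ i₀ = 0`, and every such `τ` occurs.
If `s` is a local section of the Gauss bundle with value `w` at `x`, then `∑ ∂_j F · s_j = 0` along
`X` for each `F` in the ideal; differentiating along `t` gives `∑ ∂_j F(q) t(s_j) = -Hess_F(τ, w)`.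
So `dγ(t)(w) = 0` if and only if all these Hessians vanish on `(τ, w)`
(`differential_gauss_eq_zero_iff`).

The Hessians are symmetric (`hess_comm`), and by Euler's relation `q` pairs to zero with all of `T`
(`hess_self`). The kernel in the variable `w` is the shrinking map, the kernel in `τ` together with
`q` is the degeneracy map, and by symmetry both are the same radical (`shrinkingMap_gauss`,
`degeneracyMap_eq`). Nothing is divided by an integer, so the characteristic plays no role.

The radical is cut out by linear forms with polynomial coefficients
(`mem_commonKernel_degeneracyForms`). Such a kernel has its generic dimension on a nonempty open
subset of `X`, where Cramer's rule gives regular frames (`exists_frame`,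
`isMorphismAt_of_commonKernel`); hence rationality. The same argument for the differentials of the
equations makes `γ` rational. That their kernel has generic dimension `n + 1` follows by computing
the Kähler differentials of the function field over a perfect field (`finrank_commonKernel_pderiv`).

Over the smooth locus the graph consists only of the points `(T_x X, x)`. There the second
projection is inverse to `(γ, id)` and carries `pr₁` to `γ`, so the third map agrees with the second
(`shrinkingMap_fst`). -/

/-- The common kernel, over the field `L`, of a family of linear forms with coefficients mapped
to `L` by `φ`. -/
def commonKernel {P L S σ : Type*} [CommRing P] [Field L] [Fintype σ] (φ : P →+* L)
    (lam : S → σ → P) : Submodule L (σ → L) where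
  carrier := {v | ∀ s, ∑ j, φ (lam s j) * v j = 0}
  zero_mem' := by simp
  add_mem' := by
    intro v w hv hw s
    simp only [Pi.add_apply, mul_add, Finset.sum_add_distrib, hv s, hw s, add_zero]
  smul_mem' := by
    intro c v hv s
    have : ∑ j, φ (lam s j) * (c • v) j = c * ∑ j, φ (lam s j) * v j := by
      rw [Finset.mul_sum]
      exact Finset.sum_congr rfl fun j _ => by rw [Pi.smul_apply, smul_eq_mul]; ring
    rw [this, hv s, mul_zero]

theorem mem_commonKernel {P L S σ : Type*} [CommRing P] [Field L] [Fintype σ] {φ : P →+* L}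
    {lam : S → σ → P} {v : σ → L} :
    v ∈ commonKernel φ lam ↔ ∀ s, ∑ j, φ (lam s j) * v j = 0 := Iff.rfl

/-! ### Kähler differentials and the tangent space at the generic point -/

open scoped IntermediateField.algebraAdjoinAdjoin in
/-- The module of differentials of a finitely generated extension of a perfect field has rank
equal to the transcendence degree. -/
theorem finrank_kaehlerDifferential {k K : Type*} [Field k] [PerfectField k] [Field K]
    [Algebra k K] [Algebra.EssFiniteType k K] :
    (Module.finrank K (Ω[K⁄k]) : Cardinal) = Algebra.trdeg k K := by
  -- A separating transcendence basis `s` makes `k[s] → K` formally étale, as a localization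
  -- followed by a separable algebraic extension. Hence `Ω[K⁄k]` is the base change of the free
  -- module `Ω[k[s]⁄k]`.
  obtain ⟨s, hs, H⟩ := exists_isTranscendenceBasis_and_isSeparable_of_perfectField k K
  have hB : Set.range ((↑) : s → K) = (s : Set K) := by simp
  have hsep : Algebra.IsSeparable (IntermediateField.adjoin k (Set.range ((↑) : s → K))) K := by
    rw [hB]; exact H
  have h1 : Algebra.FormallyEtale (IntermediateField.adjoin k (Set.range ((↑) : s → K))) K :=
    Algebra.FormallyEtale.of_isSeparable _ K
  have h2 : Algebra.FormallyEtale (Algebra.adjoin k (Set.range ((↑) : s → K)))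
      (IntermediateField.adjoin k (Set.range ((↑) : s → K))) :=
    .of_isLocalization (nonZeroDivisors _)
  have h3 : Algebra.FormallyEtale (Algebra.adjoin k (Set.range ((↑) : s → K))) K :=
    .comp _ (IntermediateField.adjoin k (Set.range ((↑) : s → K))) _
  let : Algebra (MvPolynomial s k) (Algebra.adjoin k (Set.range ((↑) : s → K))) :=
    hs.1.aevalEquiv.toRingHom.toAlgebra
  let : Algebra (MvPolynomial s k) K := (MvPolynomial.aeval ((↑) : s → K)).toRingHom.toAlgebra
  have : IsScalarTower (MvPolynomial s k) (Algebra.adjoin k (Set.range ((↑) : s → K))) K :=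
    .of_algebraMap_eq fun p => (hs.1.algebraMap_aevalEquiv p).symm
  have : IsScalarTower k (MvPolynomial s k) K := .of_algebraMap_eq fun c => by
    change _ = MvPolynomial.aeval _ (MvPolynomial.C c)
    simp
  have h4 : Algebra.FormallyEtale (MvPolynomial s k)
      (Algebra.adjoin k (Set.range ((↑) : s → K))) :=
    .of_equiv (A := MvPolynomial s k)
      (AlgEquiv.ofBijective (Algebra.ofId _ _) hs.1.aevalEquiv.bijective)
  have h5 : Algebra.FormallyEtale (MvPolynomial s k) K :=
    .comp _ (Algebra.adjoin k (Set.range ((↑) : s → K))) _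
  have e := KaehlerDifferential.tensorKaehlerEquivOfFormallyEtale k (MvPolynomial s k) K
  have b := ((KaehlerDifferential.mvPolynomialBasis k s).baseChange K).map e
  rw [Module.finrank_eq_card_basis b, ← hs.cardinalMk_eq_trdeg]
  simp

theorem trdeg_eq_of_isFractionRing {k : Type*} {R K : Type u} [Field k] [CommRing R] [IsDomain R]
    [Algebra k R] [Field K] [Algebra R K] [IsFractionRing R K] [Algebra k K] [IsScalarTower k R K] :
    Algebra.trdeg k K = Algebra.trdeg k R := by
  have : Algebra.IsAlgebraic R K := IsLocalization.isAlgebraic K (nonZeroDivisors R)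
  rw [← trdeg_add_eq k R (A := K), trdeg_eq_zero (R := R) (A := K), add_zero]

section TangentVectors

variable {k σ R K : Type*} [Field k] [Fintype σ] [CommRing R] [IsDomain R] [Algebra k R]
  [Field K] [Algebra R K] [IsFractionRing R K] [Algebra k K] [IsScalarTower k R K]

theorem derivation_aeval {M : Type*} [AddCommGroup M] [Module K M] [Module k M]
    (D : Derivation k K M) (x : σ → K) (F : MvPolynomial σ k) :
    D (MvPolynomial.aeval x F) =
      ∑ j, MvPolynomial.aeval x (MvPolynomial.pderiv j F) • D (x j) := by
  classical
  induction F using MvPolynomial.induction_on with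
  | C a => simp
  | add p q hp hq => simp only [map_add, hp, hq, add_smul, Finset.sum_add_distrib]
  | mul_X p i hp =>
    rw [map_mul, Derivation.leibniz, hp]
    simp only [MvPolynomial.pderiv_mul, map_add, map_mul, add_smul, Finset.sum_add_distrib,
      MvPolynomial.pderiv_X, Finset.smul_sum, mul_smul, MvPolynomial.aeval_X]
    rw [add_comm]
    congr 1
    · exact Finset.sum_congr rfl fun j _ => smul_comm _ _ _
    · rw [Finset.sum_eq_single i (by intro j _ hj; simp [hj.symm]) (by simp)]
      simp

/-- First-order Taylor expansion over the dual numbers; it turns the tangency condition on `v` into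
the existence of a ring homomorphism. -/
theorem aeval_inl_add_inr (x v : σ → K) (F : MvPolynomial σ k) :
    MvPolynomial.aeval (fun j => (TrivSqZeroExt.inl (x j) + TrivSqZeroExt.inr (v j) :
        TrivSqZeroExt K K)) F =
      TrivSqZeroExt.inl (MvPolynomial.aeval x F) +
        TrivSqZeroExt.inr (∑ j, MvPolynomial.aeval x (MvPolynomial.pderiv j F) * v j) := by
  classical
  induction F using MvPolynomial.induction_on with
  | C a =>
    simp only [MvPolynomial.algHom_C, MvPolynomial.pderiv_C, map_zero, zero_mul,
      Finset.sum_const_zero, TrivSqZeroExt.inr_zero, add_zero]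
    rfl
  | add p q hp hq =>
    simp only [map_add, hp, hq, add_mul, Finset.sum_add_distrib, TrivSqZeroExt.inl_add,
      TrivSqZeroExt.inr_add]
    abel
  | mul_X p i hp =>
    rw [map_mul, hp, MvPolynomial.aeval_X]
    apply TrivSqZeroExt.ext
    · simp
    · simp only [TrivSqZeroExt.snd_mul, TrivSqZeroExt.snd_add, TrivSqZeroExt.snd_inl,
        TrivSqZeroExt.snd_inr, TrivSqZeroExt.fst_add, TrivSqZeroExt.fst_inl,
        TrivSqZeroExt.fst_inr, zero_add, add_zero]
      simp only [MvPolynomial.pderiv_mul, map_add, map_mul, add_mul, Finset.sum_add_distrib,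
        MvPolynomial.pderiv_X]
      rw [add_comm, MulOpposite.smul_eq_mul_unop, MulOpposite.unop_op, Finset.sum_mul]
      congr 1
      · exact Finset.sum_congr rfl fun j _ => by rw [MvPolynomial.aeval_X]; ring
      · rw [Finset.sum_eq_single i (by intro j _ hj; simp [hj.symm]) (by simp)]
        simp

/-- A tangent vector at the generic point of an integral affine scheme extends to a derivation of
the function field. -/
theorem exists_derivation_of_tangent (π : MvPolynomial σ k →ₐ[k] R) (hπ : Function.Surjective π)
    (x v : σ → K) (hx : ∀ F, MvPolynomial.aeval x F = algebraMap R K (π F))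
    (hv : ∀ F, π F = 0 → ∑ j, MvPolynomial.aeval x (MvPolynomial.pderiv j F) * v j = 0) :
    ∃ D : Derivation k K K, ∀ j, D (x j) = v j := by
  have hinl : ∀ F, π F = 0 → MvPolynomial.aeval x F = 0 := fun F hF => by rw [hx, hF, map_zero]
  -- The homomorphism `X_j ↦ x_j + ε v_j` kills the ideal by tangency, and sends nonzero elements of
  -- `R` to units because their constant term is nonzero. It therefore extends to `K`, and its
  -- `ε`-part is the derivation.
  let ρ₀ : MvPolynomial σ k →ₐ[k] TrivSqZeroExt K K :=
    MvPolynomial.aeval fun j => TrivSqZeroExt.inl (x j) + TrivSqZeroExt.inr (v j)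
  have hker : ∀ F, π F = 0 → ρ₀ F = 0 := fun F hF => by
    rw [aeval_inl_add_inr, hinl F hF, hv F hF, TrivSqZeroExt.inl_zero, TrivSqZeroExt.inr_zero,
      add_zero]
  let ρ₁ : R →ₐ[k] TrivSqZeroExt K K :=
    (Ideal.Quotient.liftₐ (RingHom.ker π) ρ₀ hker).comp
      (Ideal.quotientKerAlgEquivOfSurjective hπ).symm.toAlgHom
  have hρ₁ : ∀ F, ρ₁ (π F) = ρ₀ F := fun F => by
    have : (Ideal.quotientKerAlgEquivOfSurjective hπ).symm (π F) =
        Ideal.Quotient.mk (RingHom.ker π) F := by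
      rw [AlgEquiv.symm_apply_eq]; rfl
    change Ideal.Quotient.liftₐ (RingHom.ker π) ρ₀ hker
      ((Ideal.quotientKerAlgEquivOfSurjective hπ).symm (π F)) = _
    rw [this]; rfl
  have hunit : ∀ y : nonZeroDivisors R, IsUnit (ρ₁ y) := by
    rintro ⟨y, hy⟩
    obtain ⟨F, rfl⟩ := hπ y
    rw [TrivSqZeroExt.isUnit_iff_isUnit_fst, isUnit_iff_ne_zero, hρ₁, aeval_inl_add_inr, hx]
    simpa using nonZeroDivisors.ne_zero hy
  let ρ : K →ₐ[k] TrivSqZeroExt K K := IsLocalization.liftAlgHom hunit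
  have hρ : ∀ r, ρ (algebraMap R K r) = ρ₁ r := fun r =>
    IsLocalization.lift_eq (M := nonZeroDivisors R) (g := ρ₁.toRingHom) hunit _
  have hρfst : ∀ y, (ρ y).fst = y := by
    have : (TrivSqZeroExt.fstHom k K K).comp ρ = AlgHom.id k K := by
      apply IsLocalization.algHom_ext (nonZeroDivisors R)
      ext r
      obtain ⟨F, rfl⟩ := hπ r
      change (ρ (algebraMap R K (π F))).fst = algebraMap R K (π F)
      rw [hρ, hρ₁, aeval_inl_add_inr, hx]
      simp
    exact DFunLike.congr_fun this
  let D₀ : Derivation k K K := Derivation.mk' ((TrivSqZeroExt.sndHom K K).restrictScalars k ∘ₗ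
    ρ.toLinearMap) fun a b => by
      simp [hρfst]
      ring
  refine ⟨D₀, fun j => ?_⟩
  change (ρ (x j)).snd = _
  have : x j = algebraMap R K (π (MvPolynomial.X j)) := by rw [← hx, MvPolynomial.aeval_X]
  rw [this, hρ, hρ₁]
  simp [ρ₀]

/-- Evaluation at the `d x_j` identifies the dual of `Ω[K⁄k]` with `W`. The chain rule puts the
image in `W`, `exists_derivation_of_tangent` gives surjectivity, and the quotient rule gives
injectivity, since the `d x_j` span. -/
theorem finrank_kaehler_eq_finrank_tangent (π : MvPolynomial σ k →ₐ[k] R)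
    (hπ : Function.Surjective π) (x : σ → K)
    (hx : ∀ F, MvPolynomial.aeval x F = algebraMap R K (π F)) (W : Submodule K (σ → K))
    (hW : ∀ v, v ∈ W ↔ ∀ F, π F = 0 →
      ∑ j, MvPolynomial.aeval x (MvPolynomial.pderiv j F) * v j = 0) :
    Module.finrank K W = Module.finrank K (Ω[K⁄k]) := by
  let Θ : Module.Dual K (Ω[K⁄k]) →ₗ[K] (σ → K) :=
    LinearMap.pi fun j => LinearMap.applyₗ (KaehlerDifferential.D k K (x j))
  have hΘ : LinearMap.range Θ = W := by
    apply le_antisymm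
    · rintro _ ⟨ℓ, rfl⟩
      rw [hW]
      intro F hF
      have := congrArg ℓ (derivation_aeval (KaehlerDifferential.D k K) x F)
      rw [hx, hF, map_zero, map_zero, map_zero, map_sum] at this
      simpa [Θ] using this.symm
    · intro v hv
      obtain ⟨D, hD⟩ := exists_derivation_of_tangent π hπ x v hx ((hW v).1 hv)
      refine ⟨D.liftKaehlerDifferential, funext fun j => ?_⟩
      change D.liftKaehlerDifferential (KaehlerDifferential.D k K (x j)) = _
      rw [Derivation.liftKaehlerDifferential_comp_D, hD]
  have hinj : Function.Injective Θ := by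
    rw [← LinearMap.ker_eq_bot, LinearMap.ker_eq_bot']
    intro ℓ hℓ
    have h0 : ∀ r, ℓ (KaehlerDifferential.D k K (algebraMap R K r)) = 0 := by
      intro r
      obtain ⟨F, rfl⟩ := hπ r
      rw [← hx, derivation_aeval, map_sum]
      refine Finset.sum_eq_zero fun j _ => ?_
      rw [map_smul, show ℓ (KaehlerDifferential.D k K (x j)) = 0 from congrFun hℓ j, smul_zero]
    apply LinearMap.ext_on (KaehlerDifferential.span_range_derivation k K)
    rintro _ ⟨y, rfl⟩
    obtain ⟨a, b, hb, rfl⟩ := IsFractionRing.div_surjective (A := R) y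
    rw [Derivation.leibniz_div, map_smul, map_sub, map_smul, map_smul, h0, h0]
    simp
  rw [← Subspace.dual_finrank_eq (V := Ω[K⁄k]), ← LinearMap.finrank_range_of_inj hinj, hΘ]

end TangentVectors

/-- The homomorphism from the polynomial ring to the function field of the variety of a prime
ideal. -/
def toFunctionField {P : Type*} [CommRing P] (I : Ideal P) [I.IsPrime] :
    P →+* FractionRing (P ⧸ I) :=
  (algebraMap (P ⧸ I) (FractionRing (P ⧸ I))).comp (Ideal.Quotient.mk I)

theorem toFunctionField_eq_zero {P : Type*} [CommRing P] {I : Ideal P} [I.IsPrime] {f : P} :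
    toFunctionField I f = 0 ↔ f ∈ I := by
  rw [toFunctionField, RingHom.comp_apply, FaithfulSMul.algebraMap_eq_zero_iff,
    Ideal.Quotient.eq_zero_iff_mem]

/-- The generic tangent space of a variety over a perfect field has the expected dimension. -/
theorem finrank_commonKernel_pderiv {k σ : Type*} [Field k] [PerfectField k] [Fintype σ]
    (I : Ideal (MvPolynomial σ k)) [I.IsPrime] {d : ℕ}
    (hd : Algebra.trdeg k (MvPolynomial σ k ⧸ I) = d) :
    Module.finrank (FractionRing (MvPolynomial σ k ⧸ I)) (commonKernel (toFunctionField I)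
      fun (F : I) j => MvPolynomial.pderiv j F.1) = d := by
  have hEss : Algebra.EssFiniteType k (FractionRing (MvPolynomial σ k ⧸ I)) :=
    .comp k (MvPolynomial σ k ⧸ I) _
  have h1 := finrank_kaehlerDifferential (k := k) (K := FractionRing (MvPolynomial σ k ⧸ I))
  rw [trdeg_eq_of_isFractionRing (R := MvPolynomial σ k ⧸ I), hd, Nat.cast_inj] at h1
  have hx : ∀ F : MvPolynomial σ k, MvPolynomial.aeval
      (fun j => toFunctionField I (MvPolynomial.X j)) F = toFunctionField I F := by
    intro F
    have : (IsScalarTower.toAlgHom k (MvPolynomial σ k ⧸ I)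
        (FractionRing (MvPolynomial σ k ⧸ I))).comp (Ideal.Quotient.mkₐ k I) =
        MvPolynomial.aeval fun j => toFunctionField I (MvPolynomial.X j) := by
      ext j
      simp only [AlgHom.comp_apply, MvPolynomial.aeval_X]
      rfl
    exact (DFunLike.congr_fun this F).symm
  rw [← h1]
  refine finrank_kaehler_eq_finrank_tangent (Ideal.Quotient.mkₐ k I)
    (Ideal.Quotient.mkₐ_surjective k I) _ hx _ fun v => ?_
  simp only [hx, mem_commonKernel, Subtype.forall]
  exact forall_congr' fun F => imp_congr_left Ideal.Quotient.eq_zero_iff_mem.symm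

section Projective

variable {k : Type*} [Field k] {A B : Type*} {N : ℕ}

/-! ### Open sets in homogeneous coordinates -/

/-- Basic opens are a basis of the spectrum. The polynomial `f` need not be homogeneous, since only
saturation of `U` is built into the quotient topology. -/
theorem isOpen_zariski_iff (M : HomCoords k A) {U : Set A} :
    IsOpen[M.zariski] U ↔ ∀ p : M.cone, M.proj p ∈ U → ∃ f : MvPolynomial M.idx k,
      MvPolynomial.eval p.1 f ≠ 0 ∧
        ∀ q : M.cone, MvPolynomial.eval q.1 f ≠ 0 → M.proj q ∈ U := by
  have key : ∀ (p : M.cone) (f : MvPolynomial M.idx k),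
      (MvPolynomial.pointToPoint p.1 : PrimeSpectrum (MvPolynomial M.idx k)) ∈
        PrimeSpectrum.basicOpen f ↔ MvPolynomial.eval p.1 f ≠ 0 := by
    intro p f
    rw [PrimeSpectrum.mem_basicOpen, not_iff_not]
    exact MvPolynomial.mem_vanishingIdeal_singleton_iff p.1 f
  rw [isOpen_coinduced, isOpen_induced_iff]
  constructor
  · rintro ⟨V, hV, hVU⟩ p hp
    have hpV : (MvPolynomial.pointToPoint p.1 : PrimeSpectrum (MvPolynomial M.idx k)) ∈ V := by
      have : p ∈ M.proj ⁻¹' U := hp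
      rwa [← hVU] at this
    obtain ⟨_, ⟨f, rfl⟩, hf, hfV⟩ :=
      PrimeSpectrum.isTopologicalBasis_basic_opens.exists_subset_of_mem_open hpV hV
    refine ⟨f, (key p f).1 hf, fun q hq => ?_⟩
    have : q ∈ (fun p : M.cone =>
      (MvPolynomial.pointToPoint p.1 : PrimeSpectrum (MvPolynomial M.idx k))) ⁻¹' V :=
      hfV ((key q f).2 hq)
    rwa [hVU] at this
  · intro H
    choose! f hf hfU using H
    refine ⟨⋃ p ∈ {p : M.cone | M.proj p ∈ U}, PrimeSpectrum.basicOpen (f p),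
      isOpen_biUnion fun p _ => PrimeSpectrum.isOpen_basicOpen, ?_⟩
    ext q
    simp only [Set.mem_preimage, Set.mem_iUnion, Set.mem_ofPred_eq, SetLike.mem_coe, key]
    exact ⟨fun ⟨p, hp, hq⟩ => hfU p hp q hq, fun hq => ⟨q, hq, hf q hq⟩⟩

theorem isClosed_zariski_of_forall (M : HomCoords k A) {S : Type*}
    (F : S → MvPolynomial M.idx k) {C : Set A}
    (h : ∀ p : M.cone, M.proj p ∈ C ↔ ∀ s, MvPolynomial.eval p.1 (F s) = 0) :
    IsClosed[M.zariski] C := by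
  rw [← @isOpen_compl_iff _ _ M.zariski, isOpen_zariski_iff]
  intro p hp
  rw [Set.mem_compl_iff, h, not_forall] at hp
  obtain ⟨s, hs⟩ := hp
  refine ⟨F s, hs, fun q hq => ?_⟩
  rw [Set.mem_compl_iff, h]
  exact fun H => hq (H s)

/-- The class in projective space of a nonzero vector. -/
abbrev toProj (q : Vec k N) (hq : q ≠ 0) : ℙ k (Vec k N) := Projectivization.mk k q hq

theorem toProj_smul {q : Vec k N} (hq : q ≠ 0) {c : k} (hc : c ≠ 0) :
    toProj (c • q) (smul_ne_zero hc hq) = toProj q hq :=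
  (Projectivization.mk_eq_mk_iff' k _ _ _ _).2 ⟨c, rfl⟩

theorem exists_smul_of_toProj_eq {p q : Vec k N} {hp : p ≠ 0} {hq : q ≠ 0}
    (h : toProj p hp = toProj q hq) : ∃ c : k, c ≠ 0 ∧ p = c • q := by
  obtain ⟨c, rfl⟩ := (Projectivization.mk_eq_mk_iff' k _ _ _ _).1 h
  exact ⟨c, fun h0 => hp (by rw [h0, zero_smul]), rfl⟩

/-- The polynomial `f (c X)`. -/
def scalePoly {σ : Type*} (c : k) (f : MvPolynomial σ k) : MvPolynomial σ k :=
  MvPolynomial.bind₁ (fun i => MvPolynomial.C c * MvPolynomial.X i) f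

theorem eval_scalePoly {σ : Type*} (c : k) (f : MvPolynomial σ k) (q : σ → k) :
    MvPolynomial.eval q (scalePoly c f) = MvPolynomial.eval (c • q) f := by
  have : (MvPolynomial.aeval (R := k) q).comp
      (MvPolynomial.bind₁ fun i => MvPolynomial.C c * MvPolynomial.X i) =
      MvPolynomial.aeval (c • q) := by
    ext i; simp
  exact DFunLike.congr_fun this f

theorem pderiv_scalePoly {σ : Type*} (c : k) (f : MvPolynomial σ k) (j : σ) :
    MvPolynomial.pderiv j (scalePoly c f) =
      MvPolynomial.C c * scalePoly c (MvPolynomial.pderiv j f) := by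
  classical
  unfold scalePoly
  induction f using MvPolynomial.induction_on with
  | C a => simp
  | add p q hp hq => simp only [map_add, hp, hq, mul_add]
  | mul_X p i hp =>
    simp only [map_mul, MvPolynomial.pderiv_mul, hp, MvPolynomial.bind₁_X_right, map_add,
      MvPolynomial.pderiv_C, MvPolynomial.pderiv_X, Pi.single_apply]
    split_ifs <;> simp <;> ring

theorem isOpen_proj_iff {U : Set (ℙ k (Vec k N))} :
    IsOpen[(projCoords k N).zariski] U ↔ ∀ (p : Vec k N) (hp : p ≠ 0), toProj p hp ∈ U →
      ∃ f : MvPolynomial (Fin (N + 1)) k, MvPolynomial.eval p f ≠ 0 ∧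
        ∀ (q : Vec k N) (hq : q ≠ 0), MvPolynomial.eval q f ≠ 0 → toProj q hq ∈ U :=
  (isOpen_zariski_iff _).trans
    ⟨fun h p hp hU => let ⟨f, hf, H⟩ := h ⟨p, hp⟩ hU; ⟨f, hf, fun q hq => H ⟨q, hq⟩⟩,
      fun h p hU => let ⟨f, hf, H⟩ := h p.1 p.2 hU; ⟨f, hf, fun q => H q.1 q.2⟩⟩

/-- The set of points represented by a vector at which `f` does not vanish. -/
def nonvanishing (f : MvPolynomial (Fin (N + 1)) k) : Set (ℙ k (Vec k N)) :=
  {x | ∃ (q : Vec k N) (hq : q ≠ 0), toProj q hq = x ∧ MvPolynomial.eval q f ≠ 0}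

theorem isOpen_nonvanishing (f : MvPolynomial (Fin (N + 1)) k) :
    IsOpen[(projCoords k N).zariski] (nonvanishing f) := by
  rw [isOpen_proj_iff]
  rintro p hp0 ⟨q, hq0, hqp, hq⟩
  obtain ⟨c, hc, rfl⟩ := exists_smul_of_toProj_eq hqp
  refine ⟨scalePoly c f, by rwa [eval_scalePoly], fun r hr0 hr => ?_⟩
  rw [eval_scalePoly] at hr
  exact ⟨c • r, smul_ne_zero hc hr0, toProj_smul hr0 hc, hr⟩

theorem exists_nonvanishing_subset {U : Set (ℙ k (Vec k N))}
    (hU : IsOpen[(projCoords k N).zariski] U) {q : Vec k N} (hq : q ≠ 0) (hqU : toProj q hq ∈ U) :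
    ∃ f, MvPolynomial.eval q f ≠ 0 ∧ nonvanishing f ⊆ U := by
  obtain ⟨f, hf, H⟩ := isOpen_proj_iff.1 hU q hq hqU
  refine ⟨f, hf, ?_⟩
  rintro _ ⟨r, hr, rfl, hfr⟩
  exact H r hr hfr

theorem toProj_rep (x : ℙ k (Vec k N)) : toProj x.rep x.rep_nonzero = x := x.mk_rep

/-! ### The homogeneous ideal -/

variable {X : Set (ℙ k (Vec k N))}

theorem mem_homIdeal {F : MvPolynomial (Fin (N + 1)) k} :
    F ∈ homIdeal X ↔ ∀ (q : Vec k N) (hq : q ≠ 0), toProj q hq ∈ X → MvPolynomial.eval q F = 0 :=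
  ⟨fun h q hq hx => h q ⟨hq, hx⟩, fun h q ⟨hq, hx⟩ => h q hq hx⟩

/-- Stability under `F ↦ F(cX)` stands in for homogeneity of the ideal: it makes the constructions
below independent of the representative of a point. -/
theorem scalePoly_mem_homIdeal {F : MvPolynomial (Fin (N + 1)) k} (hF : F ∈ homIdeal X) (c : k)
    (hc : c ≠ 0) : scalePoly c F ∈ homIdeal X := by
  rw [mem_homIdeal] at hF ⊢
  intro q hq hx
  rw [eval_scalePoly]
  exact hF _ (smul_ne_zero hc hq) (by rwa [toProj_smul hq hc])

/-- The restriction of a polynomial to the line through the origin and `q`. -/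
def linePoly {σ : Type*} (q : σ → k) (F : MvPolynomial σ k) : Polynomial k :=
  MvPolynomial.aeval (fun i => Polynomial.C (q i) * Polynomial.X) F

theorem eval_linePoly {σ : Type*} (q : σ → k) (F : MvPolynomial σ k) (c : k) :
    (linePoly q F).eval c = MvPolynomial.eval (c • q) F := by
  have : (Polynomial.aeval c).comp
      (MvPolynomial.aeval fun i => Polynomial.C (q i) * Polynomial.X) =
      MvPolynomial.aeval (R := k) (c • q) := by
    ext i
    simp only [AlgHom.comp_apply, MvPolynomial.aeval_X, map_mul, Polynomial.aeval_C,
      Polynomial.aeval_X, Pi.smul_apply, smul_eq_mul]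
    exact mul_comm _ _
  exact DFunLike.congr_fun this F

theorem derivative_linePoly {σ : Type*} [Fintype σ] (q : σ → k) (F : MvPolynomial σ k) :
    Polynomial.derivative (linePoly q F) =
      ∑ j, linePoly q (MvPolynomial.pderiv j F) * Polynomial.C (q j) := by
  classical
  unfold linePoly
  induction F using MvPolynomial.induction_on with
  | C a => simp
  | add p q hp hq => simp only [map_add, hp, hq, add_mul, Finset.sum_add_distrib]
  | mul_X p i hp =>
    rw [map_mul, Polynomial.derivative_mul, hp]
    simp only [MvPolynomial.pderiv_mul, map_add, map_mul, add_mul, Finset.sum_add_distrib,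
      MvPolynomial.pderiv_X, MvPolynomial.aeval_X]
    congr 1
    · rw [Finset.sum_mul]
      exact Finset.sum_congr rfl fun j _ => by ring
    · rw [Finset.sum_eq_single i (by intro j _ hj; simp [hj.symm]) (by simp)]
      simp

/-- Irreducibility gives a point of `X` where `f` and `g` are both nonzero, but possibly at
different representatives. Restricted to the line of that point, both are nonzero polynomials in one
variable, so over an infinite field a common representative exists. -/
theorem homIdeal_isPrime [Infinite k]
    (hX : @IsIrreducible _ (projCoords k N).zariski X) : (homIdeal X).IsPrime := by
  refine Ideal.isPrime_iff.2 ⟨?_, ?_⟩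
  · obtain ⟨x, hx⟩ := hX.1
    rw [Ideal.ne_top_iff_one, mem_homIdeal]
    intro h
    simpa using h x.rep x.rep_nonzero (by rwa [toProj_rep])
  · intro f g hfg
    by_contra! H
    obtain ⟨hf, hg⟩ := H
    rw [mem_homIdeal] at hf hg hfg
    push Not at hf hg
    obtain ⟨p, hp, hpX, hfp⟩ := hf
    obtain ⟨r, hr, hrX, hgr⟩ := hg
    obtain ⟨x, hx, ⟨q, hq, hqx, hfq⟩, q', hq', hqx', hgq'⟩ :=
      hX.2 _ _ (isOpen_nonvanishing f) (isOpen_nonvanishing g)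
        ⟨_, hpX, p, hp, rfl, hfp⟩ ⟨_, hrX, r, hr, rfl, hgr⟩
    obtain ⟨c, hc, rfl⟩ := exists_smul_of_toProj_eq (hqx'.trans hqx.symm)
    -- The factor `X` forces `t ≠ 0`, so that `t • q` still represents the point.
    have h0 : linePoly q f * linePoly q g * Polynomial.X ≠ 0 := by
      refine mul_ne_zero (mul_ne_zero (fun h => hfq ?_) fun h => hgq' ?_) Polynomial.X_ne_zero
      · have := eval_linePoly q f 1
        rw [h, one_smul, Polynomial.eval_zero] at this
        exact this.symm
      · rw [← eval_linePoly, h, Polynomial.eval_zero]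
    obtain ⟨t, ht⟩ : ∃ t, (linePoly q f * linePoly q g * Polynomial.X).eval t ≠ 0 := by
      by_contra! h
      exact h0 (Polynomial.funext fun t => by rw [h, Polynomial.eval_zero])
    rw [Polynomial.eval_mul, Polynomial.eval_mul, Polynomial.eval_X, eval_linePoly,
      eval_linePoly, ← map_mul] at ht
    have ht0 : t ≠ 0 := right_ne_zero_of_mul ht
    refine left_ne_zero_of_mul ht (hfg _ (smul_ne_zero ht0 hq) ?_)
    rw [toProj_smul hq ht0, hqx]
    exact hx

/-- Euler's relation for elements of the homogeneous ideal. -/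
theorem euler_homIdeal [Infinite k] {F : MvPolynomial (Fin (N + 1)) k} (hF : F ∈ homIdeal X) :
    ∑ j, MvPolynomial.X j * MvPolynomial.pderiv j F ∈ homIdeal X := by
  rw [mem_homIdeal] at hF ⊢
  intro q hq hx
  -- `F` vanishes on the punctured line through `q`; the factor `X` below covers the origin. The
  -- derivative at `1` of the zero polynomial is the Euler sum, so no degree enters.
  have h0 : linePoly q F = 0 := by
    have : Polynomial.X * linePoly q F = 0 := Polynomial.funext fun c => by
      rw [Polynomial.eval_mul, Polynomial.eval_X, eval_linePoly, Polynomial.eval_zero]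
      rcases eq_or_ne c 0 with rfl | hc
      · rw [zero_mul]
      · rw [hF _ (smul_ne_zero hc hq) (by rwa [toProj_smul hq hc]), mul_zero]
    exact (mul_eq_zero.1 this).resolve_left Polynomial.X_ne_zero
  have := congrArg (Polynomial.eval 1) (derivative_linePoly q F)
  rw [h0, Polynomial.derivative_zero, Polynomial.eval_zero, Polynomial.eval_finsetSum] at this
  simp only [Polynomial.eval_mul, eval_linePoly, one_smul, Polynomial.eval_C] at this
  rw [map_sum, this]
  exact Finset.sum_congr rfl fun j _ => by rw [map_mul, MvPolynomial.eval_X, mul_comm]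

theorem dense_of_isIrreducible (M : HomCoords k A) {Z U : Set A}
    (hZ : @IsIrreducible _ M.zariski Z) (hU : IsOpen[M.zariski] U) (h : (Z ∩ U).Nonempty) :
    Z ⊆ closure[M.zariski] (Z ∩ U) := by
  let _ := M.zariski
  intro z hz
  rw [mem_closure_iff]
  intro V hV hzV
  obtain ⟨y, hy, hyV, hyU⟩ := hZ.2 V U hV hU ⟨z, hz, hzV⟩ h
  exact ⟨y, hyV, hy, hyU⟩

end Projective

/-! ### Kernels of families of linear forms and their frames -/

section Minors

variable {P L S σ : Type*} [CommRing P] [Field L]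

/-- Row rank equals column rank, so `r` of the columns form a basis of the column space. -/
theorem exists_submatrix_det_ne_zero {L σ : Type*} [Field L] [Fintype σ] {r : ℕ}
    (M : Matrix (Fin r) σ L) (hM : LinearIndependent L M.row) :
    ∃ c : Fin r → σ, Function.Injective c ∧ (M.submatrix id c).det ≠ 0 := by
  have hcol : Module.finrank L (Submodule.span L (Set.range M.col)) = r := by
    rw [← Matrix.rank_eq_finrank_span_cols, hM.rank_matrix, Fintype.card_fin]
  obtain ⟨g, hg, -, hgli⟩ := Submodule.exists_fun_fin_finrank_span_eq L (Set.range M.col)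
  generalize Module.finrank L (Submodule.span L (Set.range M.col)) = r' at *
  subst hcol
  choose c hc using hg
  have hgc : g = (M.submatrix id c).col := by
    ext b a
    exact (congrFun (hc b) a).symm
  refine ⟨c, fun a b hab => hgli.injective ?_, ?_⟩
  · rw [← hc, ← hc, hab]
  · rw [hgc, Matrix.linearIndependent_cols_iff_isUnit, Matrix.isUnit_iff_isUnit_det] at hgli
    exact hgli.ne_zero

/-- Invertible minors of a family of linear forms: the rank of the family is complementary to
the dimension of the common kernel. -/
theorem exists_minor [Fintype σ] (φ : P →+* L) (lam : S → σ → P) {m : ℕ}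
    (hm : Module.finrank L (commonKernel φ lam) = m) :
    ∃ (r : ℕ) (s : Fin r → S) (π : Fin r ⊕ Fin m ≃ σ),
      φ (Matrix.of fun a b => lam (s a) (π (Sum.inl b))).det ≠ 0 := by
  classical
  let R : S → σ → L := fun s j => φ (lam s j)
  obtain ⟨f, hf, hspan, hli⟩ := Submodule.exists_fun_fin_finrank_span_eq L (Set.range R)
  choose s hs using hf
  let M : Matrix (Fin (Module.finrank L (Submodule.span L (Set.range R)))) σ L :=
    Matrix.of fun a j => R (s a) j
  have hM : M = Matrix.of f := by ext a j; exact congrFun (hs a) j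
  have hrank : M.rank = Module.finrank L (Submodule.span L (Set.range R)) := by
    have : LinearIndependent L M.row := by rw [hM]; exact hli
    rw [this.rank_matrix, Fintype.card_fin]
  -- The chosen forms span all the forms, so their solutions solve every equation.
  have hker : commonKernel φ lam = LinearMap.ker M.mulVecLin := by
    ext v
    rw [mem_commonKernel, LinearMap.mem_ker]
    constructor
    · intro h
      ext a
      exact h (s a)
    · intro h
      have key : ∀ w ∈ Submodule.span L (Set.range R), ∑ j, w j * v j = 0 := by
        rw [← hspan]
        intro w hw
        induction hw using Submodule.span_induction with
        | mem w hw =>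
          obtain ⟨a, rfl⟩ := hw
          rw [← hs a]
          exact congrFun h a
        | zero => simp
        | add w w' _ _ hw hw' => simp only [Pi.add_apply, add_mul, Finset.sum_add_distrib, hw, hw',
            add_zero]
        | smul c w _ hw =>
          simp only [Pi.smul_apply, smul_eq_mul, mul_assoc, ← Finset.mul_sum, hw, mul_zero]
      exact fun s => key (R s) (Submodule.subset_span ⟨s, rfl⟩)
  have hcard : Module.finrank L (Submodule.span L (Set.range R)) + m = Fintype.card σ := by
    have := LinearMap.finrank_range_add_finrank_ker M.mulVecLin
    rw [← hker, hm, Module.finrank_fintype_fun_eq_card] at this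
    exact (congrArg (· + m) hrank).symm.trans this
  obtain ⟨c, hcinj, hdet⟩ := exists_submatrix_det_ne_zero M (by rw [hM]; exact hli)
  have hcompl : Fintype.card {x // x ∉ Set.range c} = m := by
    rw [Fintype.card_subtype_compl, ← hcard]
    have : Fintype.card {x // x ∈ Set.range c} =
        Module.finrank L (Submodule.span L (Set.range R)) := by
      rw [← Fintype.card_congr (Equiv.ofInjective c hcinj), Fintype.card_fin]
    rw [this, Nat.add_sub_cancel_left]
  -- `π` lists the `r` pivot coordinates and then the `m` free ones.
  refine ⟨_, s, (Equiv.sumCongr (Equiv.ofInjective c hcinj)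
    (Fintype.equivFinOfCardEq hcompl).symm).trans (Equiv.Set.sumCompl (Set.range c)), ?_⟩
  rw [RingHom.map_det]
  exact hdet

variable {r m : ℕ} (lam : S → σ → P) (s : Fin r → S) (π : Fin r ⊕ Fin m ≃ σ)

/-- The solutions of the equations `lam (s a)`, with denominators cleared by Cramer's rule. -/
def cramerFrame (j : Fin m) (i : σ) : P :=
  Sum.elim
    (fun b => -∑ c, (Matrix.of fun a b => lam (s a) (π (Sum.inl b))).adjugate b c *
      lam (s c) (π (Sum.inr j)))
    (fun j' => if j' = j then (Matrix.of fun a b => lam (s a) (π (Sum.inl b))).det else 0)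
    (π.symm i)

theorem cramerFrame_inr (j j' : Fin m) : cramerFrame lam s π j (π (Sum.inr j')) =
    if j' = j then (Matrix.of fun a b => lam (s a) (π (Sum.inl b))).det else 0 := by
  simp [cramerFrame]

variable [Fintype σ]

/-- By `A * adjugate A = det A • 1` the pivot part cancels the free part. The identity holds in `P`
itself, before any evaluation. -/
theorem sum_mul_cramerFrame (a : Fin r) (j : Fin m) :
    ∑ i, lam (s a) i * cramerFrame lam s π j i = 0 := by
  rw [← π.sum_comp, Fintype.sum_sum_type]
  have h1 : ∀ b, cramerFrame lam s π j (π (Sum.inl b)) =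
      -((Matrix.of fun a b => lam (s a) (π (Sum.inl b))).adjugate.mulVec
        (fun c => lam (s c) (π (Sum.inr j)))) b := by
    intro b
    simp [cramerFrame, Matrix.mulVec, dotProduct]
  simp only [h1, cramerFrame_inr, mul_neg, mul_ite, mul_zero, Finset.sum_ite_eq', Finset.mem_univ,
    if_true, Finset.sum_neg_distrib]
  have h2 := congrFun (congrArg (fun A => Matrix.mulVec A fun c => lam (s c) (π (Sum.inr j)))
    (Matrix.mul_adjugate (Matrix.of fun a b => lam (s a) (π (Sum.inl b))))) a
  simp only [← Matrix.mulVec_mulVec, Matrix.smul_mulVec, Matrix.one_mulVec] at h2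
  rw [neg_add_eq_zero, mul_comm]
  exact h2

/-- With the free coordinates zero, the pivot coordinates solve a square system with invertible
matrix. So the free coordinates determine a solution. -/
theorem eq_zero_of_minor_ne_zero (φ : P →+* L)
    (hΔ : φ (Matrix.of fun a b => lam (s a) (π (Sum.inl b))).det ≠ 0) {v : σ → L}
    (hv : v ∈ commonKernel φ fun a => lam (s a)) (h0 : ∀ j, v (π (Sum.inr j)) = 0) : v = 0 := by
  rw [RingHom.map_det] at hΔ
  have h1 : (φ.mapMatrix (Matrix.of fun a b => lam (s a) (π (Sum.inl b)))).mulVec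
      (fun b => v (π (Sum.inl b))) = 0 := by
    ext a
    have := hv a
    rw [← π.sum_comp, Fintype.sum_sum_type] at this
    simp only [h0, mul_zero, Finset.sum_const_zero, add_zero] at this
    exact this
  have h2 := Matrix.eq_zero_of_mulVec_eq_zero hΔ h1
  ext i
  obtain ⟨b | j, rfl⟩ := π.surjective i
  · exact congrFun h2 b
  · exact h0 j

theorem finrank_le_of_minor_ne_zero (φ : P →+* L)
    (hΔ : φ (Matrix.of fun a b => lam (s a) (π (Sum.inl b))).det ≠ 0) :
    Module.finrank L (commonKernel φ fun a => lam (s a)) ≤ m := by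
  have := LinearMap.finrank_le_finrank_of_injective (f := (LinearMap.pi fun j : Fin m =>
    (LinearMap.proj (π (Sum.inr j)) : (σ → L) →ₗ[L] L)) ∘ₗ
      (commonKernel φ fun a => lam (s a)).subtype) (by
    rw [← LinearMap.ker_eq_bot, LinearMap.ker_eq_bot']
    intro v hv
    exact Subtype.ext (eq_zero_of_minor_ne_zero lam s π φ hΔ v.2 fun j => congrFun hv j))
  simpa using this

theorem commonKernel_le_comp (φ : P →+* L) :
    commonKernel φ lam ≤ commonKernel φ fun a => lam (s a) := fun _ hv a => hv (s a)

theorem smul_eq_sum_cramerFrame (φ : P →+* L)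
    (hΔ : φ (Matrix.of fun a b => lam (s a) (π (Sum.inl b))).det ≠ 0) {v : σ → L}
    (hv : v ∈ commonKernel φ fun a => lam (s a)) :
    φ (Matrix.of fun a b => lam (s a) (π (Sum.inl b))).det • v =
      ∑ j, v (π (Sum.inr j)) • fun i => φ (cramerFrame lam s π j i) := by
  rw [← sub_eq_zero]
  refine eq_zero_of_minor_ne_zero lam s π φ hΔ (sub_mem (Submodule.smul_mem _ _ hv)
    (Submodule.sum_mem _ fun j _ => Submodule.smul_mem _ _ fun a => ?_)) fun j => ?_
  · simpa using congrArg φ (sum_mul_cramerFrame lam s π a j)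
  · simp [cramerFrame_inr, apply_ite φ, mul_comm]

end Minors

section GenericRank

variable {P L S σ : Type*} [CommRing P] [Field L] [Fintype σ] (I : Ideal P) [I.IsPrime]
  (lam : S → σ → P)

/-- The dimension of the common kernel of a family of linear forms at the generic point. -/
def genericNullity : ℕ :=
  Module.finrank (FractionRing (P ⧸ I)) (commonKernel (toFunctionField I) lam)

/-- Semicontinuity: a minor that is nonzero under `φ` is not in `I`, hence is nonzero at the generic
point. -/
theorem genericNullity_le (φ : P →+* L) (hφ : ∀ f ∈ I, φ f = 0) :
    genericNullity I lam ≤ Module.finrank L (commonKernel φ lam) := by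
  obtain ⟨r, s, π, hΔ⟩ := exists_minor φ lam rfl
  refine (Submodule.finrank_mono (commonKernel_le_comp lam s _)).trans
    (finrank_le_of_minor_ne_zero lam s π _ fun h => hΔ (hφ _ (toFunctionField_eq_zero.1 h)))

/-- `Δ` is a maximal minor at the generic point; wherever it is nonzero it bounds the nullity. -/
theorem exists_finrank_le_genericNullity : ∃ Δ ∉ I, ∀ (φ : P →+* L), φ Δ ≠ 0 →
    Module.finrank L (commonKernel φ lam) ≤ genericNullity I lam := by
  obtain ⟨r, s, π, hΔ⟩ := exists_minor (toFunctionField I) lam rfl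
  exact ⟨_, fun h => hΔ (toFunctionField_eq_zero.2 h), fun φ hφ =>
    (Submodule.finrank_mono (commonKernel_le_comp lam s _)).trans
      (finrank_le_of_minor_ne_zero lam s π _ hφ)⟩

/-- At a point where the common kernel has the generic dimension, it has a frame with polynomial
entries. -/
theorem exists_frame (φ : P →+* L) (hφ : ∀ f ∈ I, φ f = 0) {m : ℕ}
    (hm : genericNullity I lam = m) (hφm : Module.finrank L (commonKernel φ lam) = m) :
    ∃ (Δ : P) (E : Fin m → σ → P) (c : Fin m → σ), φ Δ ≠ 0 ∧
      (∀ j j', E j (c j') = if j' = j then Δ else 0) ∧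
      (∀ j s, ∑ i, lam s i * E j i ∈ I) ∧
      ∀ ψ : P →+* L, ψ Δ ≠ 0 → ∀ v ∈ commonKernel ψ lam,
        ψ Δ • v = ∑ j, v (c j) • fun i => ψ (E j i) := by
  obtain ⟨r, s, π, hΔ⟩ := exists_minor φ lam hφm
  refine ⟨_, cramerFrame lam s π, fun j => π (Sum.inr j), hΔ, cramerFrame_inr lam s π, ?_,
    fun ψ hψ v hv => smul_eq_sum_cramerFrame lam s π ψ hψ (commonKernel_le_comp lam s ψ hv)⟩
  -- Because the nullity at `φ` is the generic one, the minor found there is maximal at the generic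
  -- point too. So the Cramer solutions of the chosen equations solve all the others modulo `I`.
  have hK : commonKernel (toFunctionField I) lam =
      commonKernel (toFunctionField I) fun a => lam (s a) := by
    apply Submodule.eq_of_le_of_finrank_le (commonKernel_le_comp lam s _)
    exact (finrank_le_of_minor_ne_zero lam s π _ fun h =>
      hΔ (hφ _ (toFunctionField_eq_zero.1 h))).trans hm.ge
  intro j t
  have : (fun i => toFunctionField I (cramerFrame lam s π j i)) ∈
      commonKernel (toFunctionField I) lam := by
    rw [hK]
    intro a
    simpa using congrArg (toFunctionField I) (sum_mul_cramerFrame lam s π a j)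
  rw [← toFunctionField_eq_zero]
  simpa using this t

end GenericRank

section Local

variable {k : Type*} [Field k] {A B : Type*} {N : ℕ}

theorem isOpen_zariski_inter (M : HomCoords k A) {U V : Set A} (hU : IsOpen[M.zariski] U)
    (hV : IsOpen[M.zariski] V) : IsOpen[M.zariski] (U ∩ V) := by
  let _ := M.zariski
  exact IsOpen.inter hU hV

/-! ### Local rings -/

section LocalFun

variable {M : HomCoords k A} {Z : Set A} {z : A}

theorem localFun_congr {φ ψ : A → k} (hφ : φ ∈ localFun M Z z) {U : Set A}
    (hU : IsOpen[M.zariski] U) (hzU : z ∈ U) (h : ∀ a ∈ Z ∩ U, ψ a = φ a) :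
    ψ ∈ localFun M Z z := by
  intro p hp
  obtain ⟨g, d, hd, H⟩ := hφ p hp
  obtain ⟨u, hu, HU⟩ := (isOpen_zariski_iff M).1 hU p (by rwa [hp])
  -- The factor `u` confines the domain of the fraction to `U`.
  refine ⟨g * u, d * u, by simpa using ⟨hd, hu⟩, fun q hq hne => ?_⟩
  rw [map_mul] at hne
  have hu' := right_ne_zero_of_mul hne
  rw [h _ ⟨hq, HU q hu'⟩, H q hq (left_ne_zero_of_mul hne), map_mul, map_mul,
    mul_div_mul_right _ _ hu']

theorem localFun_inv {φ : A → k} (hφ : φ ∈ localFun M Z z) (hz : z ∈ Z) (h0 : φ z ≠ 0) :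
    (fun a => (φ a)⁻¹) ∈ localFun M Z z := by
  intro p hp
  obtain ⟨g, d, hd, H⟩ := hφ p hp
  have hg : MvPolynomial.eval p.1 g ≠ 0 := by
    intro hg
    have := H p (by rwa [hp]) hd
    rw [hp, hg, zero_div] at this
    exact h0 this
  -- The extra factor `d` keeps the formula for `φ` valid on the new domain.
  refine ⟨d * d, d * g, by simpa using ⟨hd, hg⟩, fun q hq hne => ?_⟩
  rw [map_mul] at hne
  have hd' := left_ne_zero_of_mul hne
  simp only [H q hq hd', inv_div, map_mul]
  rw [mul_div_mul_left _ _ hd']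

theorem eval_mem_localFun {ι : Type*} {φ : ι → A → k} (hφ : ∀ i, φ i ∈ localFun M Z z)
    (G : MvPolynomial ι k) :
    (fun a => MvPolynomial.eval (fun i => φ i a) G) ∈ localFun M Z z := by
  induction G using MvPolynomial.induction_on with
  | C c =>
    simp only [MvPolynomial.eval_C]
    exact (localFun M Z z).algebraMap_mem c
  | add p q hp hq =>
    simp only [map_add]
    exact add_mem hp hq
  | mul_X p i hp =>
    simp only [map_mul, MvPolynomial.eval_X]
    exact mul_mem hp (hφ i)

theorem tangentSpace_mul (t : tangentSpace M Z z) (φ ψ : localFun M Z z) :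
    t.1 (φ * ψ) = φ.1 z * t.1 ψ + ψ.1 z * t.1 φ := t.2 φ ψ

theorem tangentSpace_one (t : tangentSpace M Z z) : t.1 1 = 0 := by
  have := tangentSpace_mul t 1 1
  rw [mul_one] at this
  simpa using this

theorem tangentSpace_algebraMap (t : tangentSpace M Z z) (c : k) :
    t.1 (algebraMap k (localFun M Z z) c) = 0 := by
  rw [Algebra.algebraMap_eq_smul_one, map_smul, tangentSpace_one, smul_zero]

/-- A tangent vector only depends on germs of functions on `Z`. -/
theorem tangentSpace_congr (t : tangentSpace M Z z) {φ ψ : localFun M Z z} {U : Set A}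
    (hU : IsOpen[M.zariski] U) (hzU : z ∈ U) (hz : z ∈ Z) (h : ∀ a ∈ Z ∩ U, φ.1 a = ψ.1 a) :
    t.1 φ = t.1 ψ := by
  classical
  -- The idempotent `χ` vanishes at `z`, so the Leibniz rule for `χ * χ = χ` gives `t χ = 0`. As `φ
  -- - ψ = (φ - ψ) * χ`, a second application finishes.
  let χ : localFun M Z z := ⟨fun a => if a ∈ Z ∩ U then 0 else 1,
    localFun_congr (zero_mem _) hU hzU fun a ha => by rw [if_pos ha]; rfl⟩
  have hχz : χ.1 z = 0 := if_pos ⟨hz, hzU⟩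
  have hχ : t.1 χ = 0 := by
    have h1 : χ * χ = χ := by
      ext a
      change χ.1 a * χ.1 a = χ.1 a
      by_cases ha : a ∈ Z ∩ U
      · rw [show χ.1 a = 0 from if_pos ha, mul_zero]
      · rw [show χ.1 a = 1 from if_neg ha, mul_one]
    have := tangentSpace_mul t χ χ
    rwa [h1, hχz, zero_mul, add_zero] at this
  have h1 : φ - ψ = (φ - ψ) * χ := by
    ext a
    change φ.1 a - ψ.1 a = (φ.1 a - ψ.1 a) * χ.1 a
    by_cases ha : a ∈ Z ∩ U
    · rw [h a ha, sub_self, zero_mul]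
    · rw [show χ.1 a = 1 from if_neg ha, mul_one]
  have h2 := tangentSpace_mul t (φ - ψ) χ
  rw [← h1, hχ, hχz, mul_zero, zero_mul, add_zero, map_sub, sub_eq_zero] at h2
  exact h2

/-- The chain rule for tangent vectors. -/
theorem tangentSpace_eval (t : tangentSpace M Z z) {ι : Type*} [Fintype ι]
    (φ : ι → localFun M Z z) (G : MvPolynomial ι k) :
    t.1 ⟨fun a => MvPolynomial.eval (fun i => (φ i).1 a) G,
        eval_mem_localFun (fun i => (φ i).2) G⟩ =
      ∑ i, MvPolynomial.eval (fun i => (φ i).1 z) (MvPolynomial.pderiv i G) * t.1 (φ i) := by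
  classical
  induction G using MvPolynomial.induction_on with
  | C c =>
    simp only [MvPolynomial.eval_C, MvPolynomial.pderiv_C, map_zero, zero_mul,
      Finset.sum_const_zero]
    exact tangentSpace_algebraMap t c
  | add p q hp hq =>
    simp only [map_add, add_mul, Finset.sum_add_distrib, ← hp, ← hq]
    rw [← map_add]
    rfl
  | mul_X p i hp =>
    simp only [MvPolynomial.pderiv_mul, map_add, map_mul, add_mul, Finset.sum_add_distrib,
      MvPolynomial.pderiv_X, MvPolynomial.eval_X]
    refine (tangentSpace_mul t ⟨_, eval_mem_localFun (fun i => (φ i).2) p⟩ (φ i)).trans ?_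
    rw [hp, add_comm, Finset.mul_sum]
    congr 1
    · exact Finset.sum_congr rfl fun j _ => by ring
    · rw [Finset.sum_eq_single i (by intro j _ hj; simp [hj.symm]) (by simp)]
      simp

end LocalFun

/-! ### Sections of a family of subspaces and the differential -/

section Section

variable {M : HomCoords k A} {Z : Set A} {z : A} {f : A → Submodule k (Vec k N)}

/-- The derivative of a vector-valued function along a tangent vector. -/
def tangentVec (t : tangentSpace M Z z) (s : Fin (N + 1) → localFun M Z z) : Vec k N :=
  fun j => t.1 (s j)

/-- The derivative of a section vanishing at `z` lies in `f z`. -/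
theorem tangentVec_mem_of_apply_eq_zero (hz : z ∈ Z) {m : ℕ} {e : Fin m → A → Vec k N}
    (he : IsFrameAt M Z f z e) (t : tangentSpace M Z z) (s : Fin (N + 1) → localFun M Z z)
    {U : Set A} (hU : IsOpen[M.zariski] U) (hzU : z ∈ U)
    (hs : ∀ y ∈ Z ∩ U, (fun j => (s j).1 y) ∈ f y) (hs0 : ∀ j, (s j).1 z = 0) :
    tangentVec t s ∈ f z := by
  classical
  obtain ⟨U', hU', hzU', hb⟩ := he.basis
  have hli := (hb z ⟨hz, hzU'⟩).1
  have hspan := (hb z ⟨hz, hzU'⟩).2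
  obtain ⟨c, hcinj, hdet⟩ := exists_submatrix_det_ne_zero (Matrix.of fun i j => e i z j) hli
  let E : Fin m → Fin (N + 1) → localFun M Z z := fun i j => ⟨fun a => e i a j, he.regular i j⟩
  let D : Matrix (Fin m) (Fin m) (localFun M Z z) := Matrix.of fun b i => E i (c b)
  -- By Cramer's rule `det D • s = ∑ w i • e i` near `z`, with `w i` regular and zero at `z`. The
  -- Leibniz rule then leaves `det D (z) • t(s) = ∑ t(w i) • e i z`.
  let w : Fin m → localFun M Z z := D.adjugate.mulVec fun b => s (c b)
  have hev : ∀ y, ∃ ev : localFun M Z z →+* k, ∀ φ, ev φ = φ.1 y := fun y =>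
    ⟨(Pi.evalRingHom (fun _ => k) y).comp (localFun M Z z).val.toRingHom, fun _ => rfl⟩
  have hcr : ∀ y ∈ Z ∩ (U ∩ U'), ∀ j, (D.det * s j).1 y = (∑ i, w i * E i j).1 y := by
    rintro y ⟨hyZ, hyU, hyU'⟩ j
    obtain ⟨ev, hev⟩ := hev y
    have hy := hs y ⟨hyZ, hyU⟩
    rw [← (hb y ⟨hyZ, hyU'⟩).2, Submodule.mem_span_range_iff_exists_fun] at hy
    obtain ⟨a, ha⟩ := hy
    have ha' : ∀ j, ev (s j) = ∑ i, a i * ev (E i j) := by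
      intro j
      rw [hev]
      simpa [hev, E] using (congrFun ha j).symm
    have h1 : (fun b => ev (s (c b))) = (ev.mapMatrix D).mulVec a := by
      ext b
      rw [ha']
      exact Finset.sum_congr rfl fun i _ => mul_comm _ _
    have h2 : (fun i => ev (w i)) = (ev.mapMatrix D).det • a := by
      have : (fun i => ev (w i)) = (ev.mapMatrix D).adjugate.mulVec fun b => ev (s (c b)) := by
        rw [← RingHom.map_adjugate]
        ext i
        simp [w, Matrix.mulVec, dotProduct]
      rw [this, h1, Matrix.mulVec_mulVec, Matrix.adjugate_mul, Matrix.smul_mulVec,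
        Matrix.one_mulVec]
    rw [← hev, ← hev, map_mul, map_sum, RingHom.map_det, ha', Finset.mul_sum]
    refine Finset.sum_congr rfl fun i _ => ?_
    rw [map_mul, show ev (w i) = _ from congrFun h2 i, Pi.smul_apply, smul_eq_mul, mul_assoc]
  have hwz : ∀ i, (w i).1 z = 0 := by
    intro i
    obtain ⟨ev, hev⟩ := hev z
    rw [← hev]
    simp [w, Matrix.mulVec, dotProduct, hev, hs0]
  have hDz : D.det.1 z ≠ 0 := by
    obtain ⟨ev, hev⟩ := hev z
    rw [← hev, RingHom.map_det, ← Matrix.det_transpose]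
    convert hdet
    ext i b
    exact hev _
  have hfin : D.det.1 z • tangentVec t s = ∑ i, t.1 (w i) • e i z := by
    ext j
    have h1 : t.1 (D.det * s j) = t.1 (∑ i, w i * E i j) :=
      tangentSpace_congr t (isOpen_zariski_inter M hU hU') ⟨hzU, hzU'⟩ hz
        fun y hy => hcr y hy j
    rw [tangentSpace_mul, hs0, zero_mul, add_zero, map_sum] at h1
    simp only [tangentSpace_mul, hwz, zero_mul, zero_add] at h1
    rw [Pi.smul_apply, smul_eq_mul, Finset.sum_apply]
    refine h1.trans (Finset.sum_congr rfl fun i _ => ?_)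
    rw [Pi.smul_apply, smul_eq_mul, mul_comm]
  have hmem : D.det.1 z • tangentVec t s ∈ f z := by
    rw [hfin, ← hspan]
    exact Submodule.sum_mem _ fun i _ => Submodule.smul_mem _ _ (Submodule.subset_span ⟨i, rfl⟩)
  exact (Submodule.smul_mem_iff _ hDz).1 hmem

theorem frameDifferential_apply (hz : z ∈ Z) {m : ℕ} {e : Fin m → A → Vec k N}
    (he : IsFrameAt M Z f z e) (t : tangentSpace M Z z) (i : Fin m) (hi : e i z ∈ f z) :
    frameDifferential M Z f z e hz he t ⟨e i z, hi⟩ =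
      (f z).mkQ (tangentVec t fun j => ⟨fun a => e i a j, he.regular i j⟩) := by
  obtain ⟨U', hU', hzU', hb⟩ := id he.basis
  have hli := (hb z ⟨hz, hzU'⟩).1
  have hspan := (hb z ⟨hz, hzU'⟩).2
  have : (⟨e i z, hi⟩ : f z) =
      ((Module.Basis.span hli).map (LinearEquiv.ofEq _ _ hspan)) i := by
    apply Subtype.ext
    simp [Module.Basis.span_apply]
  rw [this]
  unfold frameDifferential
  rw [LinearMap.comp_apply, LinearEquiv.coe_coe, Module.Basis.constr_basis]
  rfl

/-- Subtract from `s` the combination of the frame with constant coefficients and the same value at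
`z`. The difference is a section vanishing at `z`, whose derivative lies in `f z`. -/
theorem frameDifferential_apply_section (hz : z ∈ Z) {m : ℕ} {e : Fin m → A → Vec k N}
    (he : IsFrameAt M Z f z e) (t : tangentSpace M Z z)
    (s : Fin (N + 1) → localFun M Z z) {U : Set A} (hU : IsOpen[M.zariski] U) (hzU : z ∈ U)
    (hs : ∀ y ∈ Z ∩ U, (fun j => (s j).1 y) ∈ f y) (hsz : (fun j => (s j).1 z) ∈ f z) :
    frameDifferential M Z f z e hz he t ⟨fun j => (s j).1 z, hsz⟩ =
      (f z).mkQ (tangentVec t s) := by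
  obtain ⟨U', hU', hzU', hb⟩ := id he.basis
  have hspan := (hb z ⟨hz, hzU'⟩).2
  have hmem : ∀ i, e i z ∈ f z := fun i => by
    rw [← hspan]; exact Submodule.subset_span ⟨i, rfl⟩
  have h1 := hsz
  rw [← hspan, Submodule.mem_span_range_iff_exists_fun] at h1
  obtain ⟨a, ha⟩ := h1
  let E : Fin _ → Fin (N + 1) → localFun M Z z := fun i j => ⟨fun a => e i a j, he.regular i j⟩
  have hsub : (⟨fun j => (s j).1 z, hsz⟩ : f z) = ∑ i, a i • (⟨e i z, hmem i⟩ : f z) := by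
    apply Subtype.ext
    simp [← ha]
  rw [hsub, map_sum]
  simp only [map_smul, frameDifferential_apply hz he]
  rw [← sub_eq_zero]
  simp only [← map_smul, ← map_sum, ← map_sub]
  rw [Submodule.mkQ_apply, Submodule.Quotient.mk_eq_zero]
  have h2 := tangentVec_mem_of_apply_eq_zero hz he t (fun j => (∑ i, a i • E i j) - s j)
    (isOpen_zariski_inter M hU hU') ⟨hzU, hzU'⟩ (by
      rintro y ⟨hyZ, hyU, hyU'⟩
      have : (fun j => ((∑ i, a i • E i j) - s j).1 y) =
          (∑ i, a i • e i y) - fun j => (s j).1 y := by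
        ext j
        simp [E]
      rw [this]
      refine sub_mem (Submodule.sum_mem _ fun i _ => Submodule.smul_mem _ _ ?_) (hs y ⟨hyZ, hyU⟩)
      rw [← (hb y ⟨hyZ, hyU'⟩).2]
      exact Submodule.subset_span ⟨i, rfl⟩) (by
      intro j
      have := congrFun ha j
      simp only [Finset.sum_apply, Pi.smul_apply] at this
      simp [E, ← this])
  convert h2 using 1
  ext j
  have h3 : t.1 ((∑ i, a i • E i j) - s j) = (∑ i, a i * t.1 (E i j)) - t.1 (s j) := by
    rw [map_sub, map_sum]
    simp only [map_smul, smul_eq_mul]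
  simp only [tangentVec, h3, Pi.sub_apply, Finset.sum_apply, Pi.smul_apply, smul_eq_mul]
  rfl

/-- The differential of a morphism to a Grassmannian may be computed with any local section. -/
theorem differential_apply {m : ℕ} (hf : IsMorphismAt M Z m f z) (t : tangentSpace M Z z)
    (s : Fin (N + 1) → localFun M Z z) {U : Set A} (hU : IsOpen[M.zariski] U) (hzU : z ∈ U)
    (hs : ∀ y ∈ Z ∩ U, (fun j => (s j).1 y) ∈ f y) (hsz : (fun j => (s j).1 z) ∈ f z) :
    differential M Z f z t ⟨fun j => (s j).1 z, hsz⟩ = (f z).mkQ (tangentVec t s) := by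
  have hex : ∃ m : ℕ, IsMorphismAt M Z m f z := ⟨m, hf⟩
  rw [differential, dif_pos hex]
  exact frameDifferential_apply_section _ _ t s hU hzU hs hsz

/-- Local sections through every vector. -/
theorem IsMorphismAt.exists_section {m : ℕ} (hf : IsMorphismAt M Z m f z) {v : Vec k N}
    (hv : v ∈ f z) : ∃ (s : Fin (N + 1) → localFun M Z z) (U : Set A), IsOpen[M.zariski] U ∧
      z ∈ U ∧ (∀ y ∈ Z ∩ U, (fun j => (s j).1 y) ∈ f y) ∧ (fun j => (s j).1 z) = v := by
  obtain ⟨hz, e, he⟩ := hf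
  obtain ⟨U', hU', hzU', hb⟩ := id he.basis
  rw [← (hb z ⟨hz, hzU'⟩).2, Submodule.mem_span_range_iff_exists_fun] at hv
  obtain ⟨a, ha⟩ := hv
  have h1 : ∀ y, (fun j => (∑ i, a i • (⟨fun a => e i a j, he.regular i j⟩ :
      localFun M Z z)).1 y) = ∑ i, a i • e i y := by
    intro y; ext j; simp
  refine ⟨fun j => ∑ i, a i • ⟨fun a => e i a j, he.regular i j⟩, U', hU', hzU', ?_, ?_⟩
  · intro y hy
    rw [h1, ← (hb y hy).2]
    exact Submodule.sum_mem _ fun i _ => Submodule.smul_mem _ _ (Submodule.subset_span ⟨i, rfl⟩)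
  · rw [h1, ha]

end Section

end Local

section GaussMap

variable {k : Type*} [Field k] {N : ℕ} {X : Set (ℙ k (Vec k N))}

/-! ### Regular functions and morphisms on projective varieties -/

/-- Scaling the variables moves a fraction from one representative of `z` to any other. -/
theorem mem_localFun_of_eq {z : ℙ k (Vec k N)} {φ : ℙ k (Vec k N) → k} {p : Vec k N} (hp : p ≠ 0)
    (hpz : toProj p hp = z) {g d : MvPolynomial (Fin (N + 1)) k} (hd : MvPolynomial.eval p d ≠ 0)
    (H : ∀ (q : Vec k N) (hq : q ≠ 0), toProj q hq ∈ X → MvPolynomial.eval q d ≠ 0 →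
      φ (toProj q hq) = MvPolynomial.eval q g / MvPolynomial.eval q d) :
    φ ∈ localFun (projCoords k N) X z := by
  suffices h : ∀ (r : Vec k N) (hr : r ≠ 0), toProj r hr = z →
      ∃ g h : MvPolynomial (Fin (N + 1)) k, MvPolynomial.eval r h ≠ 0 ∧
        ∀ (q : Vec k N) (hq : q ≠ 0), toProj q hq ∈ X → MvPolynomial.eval q h ≠ 0 →
          φ (toProj q hq) = MvPolynomial.eval q g / MvPolynomial.eval q h by
    intro r hr
    obtain ⟨g, h, hh, H⟩ := h r.1 r.2 hr
    exact ⟨g, h, hh, fun q => H q.1 q.2⟩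
  intro r hr hrz
  obtain ⟨c, hc, rfl⟩ := exists_smul_of_toProj_eq (hpz.trans hrz.symm)
  refine ⟨scalePoly c g, scalePoly c d, by rwa [eval_scalePoly], fun q hq hqX hne => ?_⟩
  rw [eval_scalePoly] at hne
  rw [eval_scalePoly, eval_scalePoly, ← H (c • q) (smul_ne_zero hc hq)
    (by rwa [toProj_smul hq hc]) hne, toProj_smul hq hc]

theorem exists_eq_of_mem_localFun {φ : ℙ k (Vec k N) → k} {p : Vec k N} (hp : p ≠ 0)
    (hφ : φ ∈ localFun (projCoords k N) X (toProj p hp)) :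
    ∃ g h : MvPolynomial (Fin (N + 1)) k, MvPolynomial.eval p h ≠ 0 ∧
      ∀ (q : Vec k N) (hq : q ≠ 0), toProj q hq ∈ X → MvPolynomial.eval q h ≠ 0 →
        φ (toProj q hq) = MvPolynomial.eval q g / MvPolynomial.eval q h := by
  obtain ⟨g, h, hh, H⟩ := hφ ⟨p, hp⟩ rfl
  exact ⟨g, h, hh, fun q hq => H ⟨q, hq⟩⟩

/-- A regular function which does not vanish at `z` has no zeros near `z`. -/
theorem exists_isOpen_ne_zero {z : ℙ k (Vec k N)} {φ : ℙ k (Vec k N) → k}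
    (hφ : φ ∈ localFun (projCoords k N) X z) (hz : z ∈ X) (h0 : φ z ≠ 0) :
    ∃ U : Set (ℙ k (Vec k N)), IsOpen[(projCoords k N).zariski] U ∧ z ∈ U ∧
      ∀ a ∈ X ∩ U, φ a ≠ 0 := by
  rw [← toProj_rep z] at hφ hz h0 ⊢
  obtain ⟨g, d, hd, H⟩ := exists_eq_of_mem_localFun _ hφ
  rw [H _ _ hz hd, div_ne_zero_iff] at h0
  refine ⟨nonvanishing (g * d), isOpen_nonvanishing _, ⟨_, _, rfl, ?_⟩, ?_⟩
  · rw [map_mul]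
    exact mul_ne_zero h0.1 h0.2
  · rintro _ ⟨haX, q, hq, rfl, hne⟩
    rw [map_mul] at hne
    rw [H q hq haX (right_ne_zero_of_mul hne)]
    exact div_ne_zero (left_ne_zero_of_mul hne) (right_ne_zero_of_mul hne)

theorem eval_eq_zero_of_mem_homIdeal {q : Vec k N} {hq : q ≠ 0} (hqX : toProj q hq ∈ X)
    {F : MvPolynomial (Fin (N + 1)) k} (hF : F ∈ homIdeal X) : MvPolynomial.eval q F = 0 :=
  mem_homIdeal.1 hF q hq hqX

section CommonKernel

variable [(homIdeal X).IsPrime] {S : Type*} (lam : S → Fin (N + 1) → MvPolynomial (Fin (N + 1)) k)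
  {f : ℙ k (Vec k N) → Submodule k (Vec k N)} {U₀ : Set (ℙ k (Vec k N))} {m : ℕ}

/-- The common kernel of a family of linear forms with polynomial coefficients is a morphism to a
Grassmannian wherever it has the generic dimension. -/
theorem isMorphismAt_of_commonKernel (hU₀ : IsOpen[(projCoords k N).zariski] U₀)
    (hf : ∀ (q : Vec k N) (hq : q ≠ 0), toProj q hq ∈ X ∩ U₀ →
      f (toProj q hq) = commonKernel (MvPolynomial.eval q) lam)
    (hm : genericNullity (homIdeal X) lam = m) {z : ℙ k (Vec k N)} (hz : z ∈ X ∩ U₀)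
    (hfz : Module.finrank k (f z) = m) : IsMorphismAt (projCoords k N) X m f z := by
  classical
  refine ⟨hz.1, ?_⟩
  obtain ⟨p, hp0, rfl⟩ : ∃ p hp0, toProj p hp0 = z := ⟨z.rep, z.rep_nonzero, toProj_rep z⟩
  rw [hf p hp0 hz] at hfz
  obtain ⟨Δ, E, c, hΔ, hEc, hEI, hE⟩ := exists_frame (homIdeal X) lam (MvPolynomial.eval p)
    (fun F hF => eval_eq_zero_of_mem_homIdeal hz.1 hF) hm hfz
  obtain ⟨u, hu, huU⟩ := exists_nonvanishing_subset hU₀ hp0 hz.2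
  -- Dividing by `Δ` makes the coordinates `c j'` of the frame a Kronecker delta. Such a basis is
  -- determined by the subspace alone, so it does not depend on the representative `q` and descends
  -- to projective space.
  let v : Fin m → Vec k N → Vec k N := fun j q i =>
    MvPolynomial.eval q (E j i) / MvPolynomial.eval q Δ
  have hvc : ∀ j q, MvPolynomial.eval q Δ ≠ 0 → ∀ j', v j q (c j') = if j' = j then 1 else 0 := by
    intro j q hq j'
    simp only [v, hEc]
    split_ifs
    · exact div_self hq
    · rw [map_zero, zero_div]
  have hvmem : ∀ (q : Vec k N) (hq : q ≠ 0), toProj q hq ∈ X ∩ U₀ →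
      MvPolynomial.eval q Δ ≠ 0 → ∀ j, v j q ∈ f (toProj q hq) := by
    intro q hq hqX hqΔ j
    rw [hf q hq hqX]
    intro s
    have := eval_eq_zero_of_mem_homIdeal hqX.1 (hEI j s)
    simp only [map_sum, map_mul] at this
    simp only [v, ← mul_div_assoc, ← Finset.sum_div, this, zero_div]
  have hveq : ∀ (q : Vec k N) (hq : q ≠ 0), toProj q hq ∈ X ∩ U₀ →
      MvPolynomial.eval q Δ ≠ 0 → ∀ w ∈ f (toProj q hq), w = ∑ j, w (c j) • v j q := by
    intro q hq hqX hqΔ w hw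
    rw [hf q hq hqX] at hw
    have := hE _ hqΔ w hw
    rw [← smul_right_injective _ hqΔ |>.eq_iff, this, Finset.smul_sum]
    refine Finset.sum_congr rfl fun j _ => ?_
    ext i
    simp only [v, Pi.smul_apply, smul_eq_mul]
    field_simp
  let e : Fin m → ℙ k (Vec k N) → Vec k N := fun j a =>
    if h : ∃ (q : Vec k N) (hq : q ≠ 0), toProj q hq = a ∧ MvPolynomial.eval q Δ ≠ 0 then
      v j h.choose else 0
  have he : ∀ (q : Vec k N) (hq : q ≠ 0), toProj q hq ∈ X ∩ U₀ → MvPolynomial.eval q Δ ≠ 0 →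
      ∀ j, e j (toProj q hq) = v j q := by
    intro q hq hqX hqΔ j
    have hex : ∃ (q' : Vec k N) (hq' : q' ≠ 0), toProj q' hq' = toProj q hq ∧
      MvPolynomial.eval q' Δ ≠ 0 := ⟨q, hq, rfl, hqΔ⟩
    simp only [e, dif_pos hex]
    obtain ⟨hq'0, hq'q, hq'Δ⟩ := hex.choose_spec
    generalize hex.choose = q' at *
    have h1 := hvmem q' hq'0 (by rwa [hq'q]) hq'Δ j
    rw [hq'q] at h1
    rw [hveq q hq hqX hqΔ _ h1]
    simp [hvc j q' hq'Δ]
  refine ⟨e, ⟨fun j i => ?_, U₀ ∩ nonvanishing Δ,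
    isOpen_zariski_inter _ hU₀ (isOpen_nonvanishing _), ⟨hz.2, p, hp0, rfl, hΔ⟩, ?_⟩⟩
  -- The factor `u` keeps the points inside `U₀`, where `f` is known to be the common kernel.
  · refine mem_localFun_of_eq hp0 rfl (g := E j i * u) (d := Δ * u)
      (by rw [map_mul]; exact mul_ne_zero hΔ hu) fun q hq hqX hne => ?_
    rw [map_mul] at hne
    have hqu := right_ne_zero_of_mul hne
    rw [he q hq ⟨hqX, huU ⟨q, hq, rfl, hqu⟩⟩ (left_ne_zero_of_mul hne), map_mul, map_mul,
      mul_div_mul_right _ _ hqu]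
  · rintro _ ⟨hyX, hyU, q, hq, rfl, hqΔ⟩
    simp only [he q hq ⟨hyX, hyU⟩ hqΔ]
    constructor
    · rw [Fintype.linearIndependent_iff]
      intro a ha j
      have := congrFun ha (c j)
      simpa [hvc _ q hqΔ] using this
    · apply le_antisymm
      · rw [Submodule.span_le]
        rintro _ ⟨j, rfl⟩
        exact hvmem q hq ⟨hyX, hyU⟩ hqΔ j
      · intro w hw
        rw [hveq q hq ⟨hyX, hyU⟩ hqΔ w hw]
        exact Submodule.sum_mem _ fun j _ => Submodule.smul_mem _ _
          (Submodule.subset_span ⟨j, rfl⟩)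

/-- The common kernel has the generic dimension on a nonempty open set. -/
theorem exists_isOpen_finrank_eq (hU₀ : IsOpen[(projCoords k N).zariski] U₀)
    (hX : @IsIrreducible _ (projCoords k N).zariski X) (hne : (X ∩ U₀).Nonempty)
    (hf : ∀ (q : Vec k N) (hq : q ≠ 0), toProj q hq ∈ X ∩ U₀ →
      f (toProj q hq) = commonKernel (MvPolynomial.eval q) lam) :
    ∃ U : Set (ℙ k (Vec k N)), IsOpen[(projCoords k N).zariski] U ∧ (X ∩ U).Nonempty ∧ U ⊆ U₀ ∧
      ∀ z ∈ X ∩ U, Module.finrank k (f z) = genericNullity (homIdeal X) lam := by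
  obtain ⟨Δ, hΔ, H⟩ := exists_finrank_le_genericNullity (L := k) (homIdeal X) lam
  rw [mem_homIdeal] at hΔ
  push Not at hΔ
  obtain ⟨p, hp, hpX, hpΔ⟩ := hΔ
  obtain ⟨y, hyX, hyU⟩ := hne
  obtain ⟨x, hx⟩ := hX.2 _ _ hU₀ (isOpen_nonvanishing Δ) ⟨y, hyX, hyU⟩ ⟨_, hpX, p, hp, rfl, hpΔ⟩
  refine ⟨U₀ ∩ nonvanishing Δ, isOpen_zariski_inter _ hU₀ (isOpen_nonvanishing _), ⟨x, hx⟩,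
    Set.inter_subset_left, ?_⟩
  rintro _ ⟨hzX, hzU, q, hq, rfl, hqΔ⟩
  rw [hf q hq ⟨hzX, hzU⟩]
  exact le_antisymm (H _ hqΔ)
    (genericNullity_le _ _ _ fun F hF => eval_eq_zero_of_mem_homIdeal hzX hF)

end CommonKernel

/-! ### The Gauss map -/

/-- The differentials of the equations of `X`. -/
def gaussForms (X : Set (ℙ k (Vec k N))) (F : homIdeal X) (j : Fin (N + 1)) :
    MvPolynomial (Fin (N + 1)) k :=
  MvPolynomial.pderiv j F.1

theorem commonKernel_gaussForms_smul_le {c : k} (hc : c ≠ 0) (q : Vec k N) :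
    commonKernel (MvPolynomial.eval q) (gaussForms X) ≤
      commonKernel (MvPolynomial.eval (c • q)) (gaussForms X) := by
  intro v hv F
  have := hv ⟨_, scalePoly_mem_homIdeal F.2 c hc⟩
  simp only [gaussForms, pderiv_scalePoly, map_mul, MvPolynomial.eval_C, eval_scalePoly,
    mul_assoc, ← Finset.mul_sum] at this
  exact (mul_eq_zero.1 this).resolve_left hc

/-- The definition evaluates at the chosen representative `rep`; by scaling, any representative
gives the same space. -/
theorem embTangentSpace_toProj (q : Vec k N) (hq : q ≠ 0) :
    embTangentSpace X (toProj q hq) = commonKernel (MvPolynomial.eval q) (gaussForms X) := by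
  have h1 : embTangentSpace X (toProj q hq) =
      commonKernel (MvPolynomial.eval (toProj q hq).rep) (gaussForms X) := by
    ext v
    simp only [embTangentSpace, Submodule.mem_iInf, LinearMap.mem_ker, mem_commonKernel,
      Subtype.forall, LinearMap.sum_apply, LinearMap.smul_apply, LinearMap.proj_apply,
      smul_eq_mul]
    rfl
  obtain ⟨c, hc, hcq⟩ := exists_smul_of_toProj_eq (toProj_rep (toProj q hq))
  rw [h1, hcq]
  refine le_antisymm ?_ (commonKernel_gaussForms_smul_le hc q)
  have := commonKernel_gaussForms_smul_le (X := X) (inv_ne_zero hc) (c • q)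
  rwa [inv_smul_smul₀ hc] at this

theorem genericNullity_gaussForms [PerfectField k] [(homIdeal X).IsPrime] {n : ℕ}
    (hn : HasDim X n) : genericNullity (homIdeal X) (gaussForms X) = n + 1 :=
  finrank_commonKernel_pderiv (homIdeal X) hn

/-- The Gauss map is a morphism at every smooth point. -/
theorem IsSmoothPoint.isMorphismAt [PerfectField k] [(homIdeal X).IsPrime] {n : ℕ}
    (hn : HasDim X n) {x : ℙ k (Vec k N)} (hx : IsSmoothPoint X n x) :
    IsMorphismAt (projCoords k N) X (n + 1) (embTangentSpace X) x :=
  isMorphismAt_of_commonKernel (gaussForms X) (U₀ := Set.univ)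
    (@isOpen_univ _ (projCoords k N).zariski) (fun q hq _ => embTangentSpace_toProj q hq)
    (genericNullity_gaussForms hn) ⟨hx.1, trivial⟩ hx.2

theorem exists_isOpen_isSmoothPoint [PerfectField k] [(homIdeal X).IsPrime]
    (hX : @IsIrreducible _ (projCoords k N).zariski X) {n : ℕ} (hn : HasDim X n) :
    ∃ U : Set (ℙ k (Vec k N)), IsOpen[(projCoords k N).zariski] U ∧ (X ∩ U).Nonempty ∧
      ∀ z ∈ X ∩ U, IsSmoothPoint X n z := by
  obtain ⟨U, hU, hne, -, H⟩ := exists_isOpen_finrank_eq (gaussForms X) (U₀ := Set.univ)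
    (@isOpen_univ _ (projCoords k N).zariski) hX (by simpa using hX.1)
    (fun q hq _ => embTangentSpace_toProj q hq)
  exact ⟨U, hU, hne, fun z hz => ⟨hz.1, (H z hz).trans (genericNullity_gaussForms hn)⟩⟩

/-- Nearby points of a smooth point are smooth. -/
theorem IsSmoothPoint.exists_isOpen [PerfectField k] [(homIdeal X).IsPrime] {n : ℕ}
    (hn : HasDim X n) {x : ℙ k (Vec k N)} (hx : IsSmoothPoint X n x) :
    ∃ U : Set (ℙ k (Vec k N)), IsOpen[(projCoords k N).zariski] U ∧ x ∈ U ∧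
      ∀ z ∈ X ∩ U, IsSmoothPoint X n z := by
  obtain ⟨-, e, he⟩ := hx.isMorphismAt hn
  obtain ⟨U, hU, hxU, H⟩ := he.basis
  refine ⟨U, hU, hxU, fun z hz => ⟨hz.1, ?_⟩⟩
  rw [← (H z hz).2, finrank_span_eq_card (H z hz).1, Fintype.card_fin]

/-! ### The second fundamental form -/

/-- The Hessian of `F` at `q`. -/
def hess (q : Vec k N) (F : MvPolynomial (Fin (N + 1)) k) :
    Vec k N →ₗ[k] Vec k N →ₗ[k] k :=
  Matrix.toLinearMap₂' k
    (Matrix.of fun i j => MvPolynomial.eval q (MvPolynomial.pderiv i (MvPolynomial.pderiv j F)))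

theorem hess_apply (q : Vec k N) (F : MvPolynomial (Fin (N + 1)) k) (v w : Vec k N) :
    hess q F v w = ∑ i, ∑ j, MvPolynomial.eval q
      (MvPolynomial.pderiv i (MvPolynomial.pderiv j F)) * v i * w j := by
  simp only [hess, Matrix.toLinearMap₂'_apply, Matrix.of_apply, smul_eq_mul]
  exact Finset.sum_congr rfl fun i _ => Finset.sum_congr rfl fun j _ => by ring

/-- The commutator of two derivations is a derivation, and this one kills the variables. -/
theorem pderiv_comm {σ : Type*} (i j : σ) (F : MvPolynomial σ k) :
    MvPolynomial.pderiv i (MvPolynomial.pderiv j F) =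
      MvPolynomial.pderiv j (MvPolynomial.pderiv i F) := by
  classical
  have : ⁅MvPolynomial.pderiv (R := k) i, MvPolynomial.pderiv (R := k) j⁆ = 0 := by
    apply MvPolynomial.derivation_ext
    intro l
    simp [Derivation.commutator_apply, MvPolynomial.pderiv_X, Pi.single_apply, apply_ite]
  have h2 := DFunLike.congr_fun this F
  rwa [Derivation.commutator_apply, Derivation.zero_apply, sub_eq_zero] at h2

theorem hess_comm (q : Vec k N) (F : MvPolynomial (Fin (N + 1)) k) (v w : Vec k N) :
    hess q F v w = hess q F w v := by
  rw [hess_apply, hess_apply, Finset.sum_comm]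
  refine Finset.sum_congr rfl fun i _ => Finset.sum_congr rfl fun j _ => ?_
  rw [pderiv_comm]
  ring

theorem self_mem_embTangentSpace [Infinite k] {q : Vec k N} {hq : q ≠ 0}
    (hqX : toProj q hq ∈ X) : q ∈ embTangentSpace X (toProj q hq) := by
  rw [embTangentSpace_toProj]
  intro F
  have := eval_eq_zero_of_mem_homIdeal hqX (euler_homIdeal F.2)
  simp only [map_sum, map_mul, MvPolynomial.eval_X] at this
  rw [← this]
  exact Finset.sum_congr rfl fun j _ => mul_comm _ _

/-- The Euler sum `∑ X_j ∂_j F` is in the ideal, so its derivative along `v` vanishes. That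
derivative is `∑ ∂_j F(q) v_j + Hess_F(v, q)`, and the first sum is already zero. -/
theorem hess_self [Infinite k] {q : Vec k N} {hq : q ≠ 0}
    {F : MvPolynomial (Fin (N + 1)) k} (hF : F ∈ homIdeal X) {v : Vec k N}
    (hv : v ∈ embTangentSpace X (toProj q hq)) : hess q F v q = 0 := by
  classical
  rw [embTangentSpace_toProj] at hv
  have h1 := hv ⟨_, euler_homIdeal hF⟩
  have h2 := hv ⟨F, hF⟩
  simp only [gaussForms, map_sum, MvPolynomial.pderiv_mul, MvPolynomial.pderiv_X,
    map_add, map_mul, MvPolynomial.eval_X, Finset.sum_mul, add_mul, Finset.sum_add_distrib] at h1 h2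
  have h3 : ∑ x, ∑ i, MvPolynomial.eval q ((Pi.single x 1 : Fin (N + 1) → MvPolynomial (Fin (N + 1)) k) i) *
      MvPolynomial.eval q (MvPolynomial.pderiv i F) * v x = 0 := by
    rw [← h2]
    refine Finset.sum_congr rfl fun i _ => ?_
    rw [Finset.sum_eq_single i (by intro j _ hj; simp [hj]) (by simp)]
    simp
  rw [h3, zero_add] at h1
  rw [hess_apply, ← h1]
  exact Finset.sum_congr rfl fun i _ => Finset.sum_congr rfl fun j _ => by ring

/-- Polynomial vector fields which are tangent to the cone over `X`. -/
abbrev TangentField (X : Set (ℙ k (Vec k N))) : Type _ :=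
  {G : Fin (N + 1) → MvPolynomial (Fin (N + 1)) k //
    ∀ F : homIdeal X, ∑ j, gaussForms X F j * G j ∈ homIdeal X}

/-- Linear forms with polynomial coefficients that define the kernel of the second fundamental
form. -/
def degeneracyForms (X : Set (ℙ k (Vec k N))) :
    homIdeal X ⊕ (homIdeal X × TangentField X) → Fin (N + 1) → MvPolynomial (Fin (N + 1)) k :=
  Sum.elim (gaussForms X) fun P i =>
    ∑ j, MvPolynomial.pderiv i (MvPolynomial.pderiv j P.1.1) * P.2.1 j

/-- The kernel of the second fundamental form, as a subspace of the embedded tangent space. -/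
theorem mem_commonKernel_degeneracyForms [PerfectField k] [(homIdeal X).IsPrime] {n : ℕ}
    (hn : HasDim X n) {q : Vec k N} {hq : q ≠ 0} (hx : IsSmoothPoint X n (toProj q hq))
    {v : Vec k N} : v ∈ commonKernel (MvPolynomial.eval q) (degeneracyForms X) ↔
      v ∈ embTangentSpace X (toProj q hq) ∧ ∀ w ∈ embTangentSpace X (toProj q hq),
        ∀ F ∈ homIdeal X, hess q F v w = 0 := by
  have key : ∀ (F : homIdeal X) (G : TangentField X),
      ∑ i, MvPolynomial.eval q (degeneracyForms X (Sum.inr (F, G)) i) * v i =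
        hess q F.1 v fun j => MvPolynomial.eval q (G.1 j) := by
    intro F G
    simp only [degeneracyForms, Sum.elim_inr, map_sum, map_mul, hess_apply, Finset.sum_mul]
    exact Finset.sum_congr rfl fun i _ => Finset.sum_congr rfl fun j _ => by ring
  have hT := embTangentSpace_toProj (X := X) q hq
  constructor
  · intro hv
    have hv1 : v ∈ embTangentSpace X (toProj q hq) := by
      rw [hT]
      exact fun F => hv (Sum.inl F)
    refine ⟨hv1, fun w hw F hF => ?_⟩
    -- The Cramer frame consists of polynomial tangent fields, and up to the factor `Δ(q) ≠ 0` every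
    -- `w` in the tangent space is a combination of their values at `q`.
    obtain ⟨Δ, E, c, hΔ, hEc, hEI, hE⟩ := exists_frame (homIdeal X) (gaussForms X)
      (MvPolynomial.eval q) (fun F hF => eval_eq_zero_of_mem_homIdeal hx.1 hF)
      (genericNullity_gaussForms hn) (by rw [← hT]; exact hx.2)
    have h1 : MvPolynomial.eval q Δ • hess q F v w = 0 := by
      rw [← map_smul, hE _ hΔ w (by rwa [← hT]), map_sum]
      refine Finset.sum_eq_zero fun j _ => ?_
      rw [map_smul, ← key ⟨F, hF⟩ ⟨E j, hEI j⟩, hv, smul_zero]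
    exact (smul_eq_zero.1 h1).resolve_left hΔ
  · rintro ⟨hv, H⟩ (F | ⟨F, G⟩)
    · rw [hT] at hv
      exact hv F
    · rw [key]
      refine H _ ?_ F.1 F.2
      rw [hT]
      intro F'
      simpa using eval_eq_zero_of_mem_homIdeal hx.1 (G.2 F')

end GaussMap

section SecondForm

variable {k : Type*} [Field k] {N : ℕ} {X : Set (ℙ k (Vec k N))}

/-! ### Tangent vectors of projective varieties -/

/-- The affine coordinates on the chart where the coordinate `i₀` does not vanish. -/
def affineCoord (i₀ : Fin (N + 1)) (j : Fin (N + 1)) (a : ℙ k (Vec k N)) : k :=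
  a.rep j / a.rep i₀

theorem affineCoord_toProj (i₀ j : Fin (N + 1)) (q : Vec k N) (hq : q ≠ 0) :
    affineCoord i₀ j (toProj q hq) = q j / q i₀ := by
  obtain ⟨c, hc, hcq⟩ := exists_smul_of_toProj_eq (toProj_rep (toProj q hq))
  simp only [affineCoord, hcq, Pi.smul_apply, smul_eq_mul]
  rw [mul_div_mul_left _ _ hc]

theorem exists_toProj_affineCoord {i₀ : Fin (N + 1)} {a : ℙ k (Vec k N)}
    (ha : a ∈ nonvanishing (MvPolynomial.X i₀ : MvPolynomial (Fin (N + 1)) k)) :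
    ∃ h, toProj (fun j => affineCoord i₀ j a) h = a := by
  obtain ⟨q, hq, rfl, hqi⟩ := ha
  rw [MvPolynomial.eval_X] at hqi
  have h1 : (fun j => affineCoord i₀ j (toProj q hq)) = (q i₀)⁻¹ • q := by
    ext j
    rw [affineCoord_toProj, Pi.smul_apply, smul_eq_mul, div_eq_inv_mul]
  simp only [h1]
  exact ⟨smul_ne_zero (inv_ne_zero hqi) hq, toProj_smul hq (inv_ne_zero hqi)⟩

theorem exists_normalized_rep (x : ℙ k (Vec k N)) :
    ∃ (q : Vec k N) (hq : q ≠ 0) (i₀ : Fin (N + 1)), q i₀ = 1 ∧ toProj q hq = x := by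
  obtain ⟨i₀, hi⟩ := Function.ne_iff.1 x.rep_nonzero
  refine ⟨(x.rep i₀)⁻¹ • x.rep, smul_ne_zero (inv_ne_zero hi) x.rep_nonzero, i₀,
    inv_mul_cancel₀ hi, ?_⟩
  rw [toProj_smul x.rep_nonzero (inv_ne_zero hi), toProj_rep]

section Chart

variable {q : Vec k N} {hq : q ≠ 0} {i₀ : Fin (N + 1)} (hi : q i₀ = 1)

include hi in
theorem affineCoord_self (j : Fin (N + 1)) : affineCoord i₀ j (toProj q hq) = q j := by
  rw [affineCoord_toProj, hi, div_one]

include hi in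
theorem mem_chart : toProj q hq ∈
    nonvanishing (MvPolynomial.X i₀ : MvPolynomial (Fin (N + 1)) k) :=
  ⟨q, hq, rfl, by rw [MvPolynomial.eval_X, hi]; exact one_ne_zero⟩

/-- The tautological section over the chart. -/
def affineSection (X : Set (ℙ k (Vec k N))) (hi : q i₀ = 1) (j : Fin (N + 1)) :
    localFun (projCoords k N) X (toProj q hq) :=
  ⟨affineCoord i₀ j, mem_localFun_of_eq hq rfl (g := MvPolynomial.X j)
    (d := MvPolynomial.X i₀) (by rw [MvPolynomial.eval_X, hi]; exact one_ne_zero)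
    fun r hr _ _ => by rw [affineCoord_toProj, MvPolynomial.eval_X, MvPolynomial.eval_X]⟩

/-- The vector `τ` with `i₀`-th coordinate `0` that represents a tangent vector. -/
abbrev coordVec (hi : q i₀ = 1) (t : tangentSpace (projCoords k N) X (toProj q hq)) : Vec k N :=
  tangentVec t (affineSection X hi)

/-- The derivative of a polynomial in the affine coordinates. -/
theorem tangentSpace_affine_eval (t : tangentSpace (projCoords k N) X (toProj q hq))
    (G : MvPolynomial (Fin (N + 1)) k) :
    t.1 ⟨fun a => MvPolynomial.eval (fun j => affineCoord i₀ j a) G,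
        eval_mem_localFun (fun j => (affineSection X hi j).2) G⟩ =
      ∑ j, MvPolynomial.eval q (MvPolynomial.pderiv j G) * coordVec hi t j := by
  refine (tangentSpace_eval t (affineSection X hi) G).trans ?_
  have : (fun i => affineCoord i₀ i (toProj q hq)) = q := funext (affineCoord_self hi)
  change ∑ i, MvPolynomial.eval (fun i => affineCoord i₀ i (toProj q hq)) _ * _ = _
  rw [this]
  rfl

/-- `F` of the affine coordinates vanishes on `X` throughout the chart, so its derivative along `t`
is zero. -/
theorem coordVec_mem (hqX : toProj q hq ∈ X)
    (t : tangentSpace (projCoords k N) X (toProj q hq)) :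
    coordVec hi t ∈ embTangentSpace X (toProj q hq) := by
  rw [embTangentSpace_toProj]
  intro F
  refine (tangentSpace_affine_eval hi t F.1).symm.trans ?_
  refine (tangentSpace_congr t (ψ := 0) (isOpen_nonvanishing (MvPolynomial.X i₀)) (mem_chart hi)
    hqX ?_).trans (map_zero t.1)
  rintro a ⟨haX, ha⟩
  obtain ⟨h, h2⟩ := exists_toProj_affineCoord ha
  exact mem_homIdeal.1 F.2 _ h (by rwa [h2])

/-- The derivative of a polynomial at `q` in the direction `τ`. -/
def dirDeriv (q τ : Vec k N) (g : MvPolynomial (Fin (N + 1)) k) : k :=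
  ∑ j, MvPolynomial.eval q (MvPolynomial.pderiv j g) * τ j

theorem dirDeriv_add (q τ : Vec k N) (g h : MvPolynomial (Fin (N + 1)) k) :
    dirDeriv q τ (g + h) = dirDeriv q τ g + dirDeriv q τ h := by
  simp only [dirDeriv, map_add, add_mul, Finset.sum_add_distrib]

theorem dirDeriv_sub (q τ : Vec k N) (g h : MvPolynomial (Fin (N + 1)) k) :
    dirDeriv q τ (g - h) = dirDeriv q τ g - dirDeriv q τ h := by
  simp only [dirDeriv, map_sub, sub_mul, Finset.sum_sub_distrib]

theorem dirDeriv_mul (q τ : Vec k N) (g h : MvPolynomial (Fin (N + 1)) k) :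
    dirDeriv q τ (g * h) =
      MvPolynomial.eval q g * dirDeriv q τ h + MvPolynomial.eval q h * dirDeriv q τ g := by
  simp only [dirDeriv, MvPolynomial.pderiv_mul, map_add, map_mul, Finset.mul_sum,
    ← Finset.sum_add_distrib]
  exact Finset.sum_congr rfl fun j _ => by ring

theorem dirDeriv_C (q τ : Vec k N) (c : k) : dirDeriv q τ (MvPolynomial.C c) = 0 := by
  simp [dirDeriv]

theorem dirDeriv_X (q τ : Vec k N) (i : Fin (N + 1)) :
    dirDeriv q τ (MvPolynomial.X i) = τ i := by
  classical
  rw [dirDeriv, Finset.sum_eq_single i (by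
    intro j _ hj; simp [MvPolynomial.pderiv_X_of_ne hj.symm]) (by simp)]
  simp

/-- `φ` is the quotient of `g` by `d` on `X` near the class of `q`. -/
def IsFraction (X : Set (ℙ k (Vec k N))) (q : Vec k N) (φ : ℙ k (Vec k N) → k)
    (g d : MvPolynomial (Fin (N + 1)) k) : Prop :=
  MvPolynomial.eval q d ≠ 0 ∧ ∀ (r : Vec k N) (hr : r ≠ 0), toProj r hr ∈ X →
    MvPolynomial.eval r d ≠ 0 →
      φ (toProj r hr) = MvPolynomial.eval r g / MvPolynomial.eval r d

/-- The quotient rule. -/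
def fractionDeriv (q τ : Vec k N) (c : k) (g d : MvPolynomial (Fin (N + 1)) k) : k :=
  (dirDeriv q τ g - c * dirDeriv q τ d) / MvPolynomial.eval q d

theorem IsFraction.eval_num {φ : ℙ k (Vec k N) → k} {g d : MvPolynomial (Fin (N + 1)) k}
    (h : IsFraction X q φ g d) (hqX : toProj q hq ∈ X) :
    MvPolynomial.eval q g = φ (toProj q hq) * MvPolynomial.eval q d := by
  rw [h.2 q hq hqX h.1, div_mul_cancel₀ _ h.1]

theorem fractionDeriv_eq {τ : Vec k N} (hqX : toProj q hq ∈ X)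
    (hτ : τ ∈ embTangentSpace X (toProj q hq)) {φ : ℙ k (Vec k N) → k}
    {g d g' d' : MvPolynomial (Fin (N + 1)) k} (h : IsFraction X q φ g d)
    (h' : IsFraction X q φ g' d') :
    fractionDeriv q τ (φ (toProj q hq)) g d = fractionDeriv q τ (φ (toProj q hq)) g' d' := by
  -- The factor `d * d'` handles the points where a denominator vanishes and the fractions say
  -- nothing.
  have hF : (g * d' - g' * d) * (d * d') ∈ homIdeal X := by
    rw [mem_homIdeal]
    intro r hr hrX
    simp only [map_mul, map_sub]
    by_cases h1 : MvPolynomial.eval r d = 0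
    · rw [h1]; ring
    by_cases h2 : MvPolynomial.eval r d' = 0
    · rw [h2]; ring
    have h3 := (h.2 r hr hrX h1).symm.trans (h'.2 r hr hrX h2)
    rw [div_eq_div_iff h1 h2] at h3
    rw [h3, sub_self, zero_mul]
  rw [embTangentSpace_toProj] at hτ
  have h0 : dirDeriv q τ ((g * d' - g' * d) * (d * d')) = 0 := hτ ⟨_, hF⟩
  rw [dirDeriv_mul, dirDeriv_sub, dirDeriv_mul q τ g, dirDeriv_mul q τ g'] at h0
  simp only [map_sub, map_mul, h.eval_num hqX, h'.eval_num hqX] at h0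
  have h1 := h.1
  have h2 := h'.1
  rw [fractionDeriv, fractionDeriv, div_eq_div_iff h1 h2]
  have h3 := mul_ne_zero h1 h2
  apply mul_left_cancel₀ h3
  linear_combination h0

/-- Every vector in the embedded tangent space whose `i₀`-th coordinate vanishes comes from a
tangent vector. -/
theorem exists_coordVec_eq (hqX : toProj q hq ∈ X) {τ : Vec k N}
    (hτ : τ ∈ embTangentSpace X (toProj q hq)) (hτi : τ i₀ = 0) :
    ∃ t : tangentSpace (projCoords k N) X (toProj q hq), coordVec hi t = τ := by
  have hex : ∀ φ : localFun (projCoords k N) X (toProj q hq), ∃ g d, IsFraction X q φ.1 g d :=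
    fun φ => exists_eq_of_mem_localFun hq φ.2
  -- The derivation is the quotient rule along `τ` applied to a chosen fraction. By
  -- `fractionDeriv_eq` the choice is immaterial, so additivity and the Leibniz rule may be checked
  -- on convenient fractions.
  choose g d hgd using hex
  let D : localFun (projCoords k N) X (toProj q hq) → k := fun φ =>
    fractionDeriv q τ (φ.1 (toProj q hq)) (g φ) (d φ)
  have hD : ∀ (φ : localFun (projCoords k N) X (toProj q hq)) g' d', IsFraction X q φ.1 g' d' →
      D φ = fractionDeriv q τ (φ.1 (toProj q hq)) g' d' := fun φ g' d' h =>
    fractionDeriv_eq hqX hτ (hgd φ) h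
  let L : localFun (projCoords k N) X (toProj q hq) →ₗ[k] k :=
    { toFun := D
      map_add' := by
        intro φ ψ
        have h1 := hgd φ
        have h2 := hgd ψ
        rw [hD (φ + ψ) (g φ * d ψ + d φ * g ψ) (d φ * d ψ) ⟨by
          rw [map_mul]; exact mul_ne_zero h1.1 h2.1, fun r hr hrX hne => by
          rw [map_mul] at hne
          have e1 := left_ne_zero_of_mul hne
          have e2 := right_ne_zero_of_mul hne
          change φ.1 _ + ψ.1 _ = _
          rw [h1.2 r hr hrX e1, h2.2 r hr hrX e2, div_add_div _ _ e1 e2]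
          simp⟩]
        change fractionDeriv q τ (φ.1 (toProj q hq) + ψ.1 (toProj q hq)) _ _ =
          fractionDeriv q τ (φ.1 (toProj q hq)) _ _ + fractionDeriv q τ (ψ.1 (toProj q hq)) _ _
        have e1 := h1.1
        have e2 := h2.1
        simp only [fractionDeriv, dirDeriv_add, dirDeriv_mul, map_mul, h1.eval_num hqX,
          h2.eval_num hqX]
        field_simp
        ring
      map_smul' := by
        intro c φ
        have h1 := hgd φ
        rw [hD (c • φ) (MvPolynomial.C c * g φ) (d φ) ⟨h1.1, fun r hr hrX hne => by
          change c * φ.1 _ = _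
          rw [h1.2 r hr hrX hne, map_mul, MvPolynomial.eval_C, mul_div_assoc]⟩]
        change fractionDeriv q τ (c * φ.1 (toProj q hq)) _ _ =
          c * fractionDeriv q τ (φ.1 (toProj q hq)) _ _
        simp only [fractionDeriv, dirDeriv_mul, dirDeriv_C, MvPolynomial.eval_C]
        ring }
  refine ⟨⟨L, fun φ ψ => ?_⟩, ?_⟩
  · change D (φ * ψ) = φ.1 _ * D ψ + ψ.1 _ * D φ
    have h1 := hgd φ
    have h2 := hgd ψ
    rw [hD (φ * ψ) (g φ * g ψ) (d φ * d ψ) ⟨by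
      rw [map_mul]; exact mul_ne_zero h1.1 h2.1, fun r hr hrX hne => by
      rw [map_mul] at hne
      change φ.1 _ * ψ.1 _ = _
      rw [h1.2 r hr hrX (left_ne_zero_of_mul hne), h2.2 r hr hrX (right_ne_zero_of_mul hne),
        div_mul_div_comm, map_mul, map_mul]⟩]
    change fractionDeriv q τ (φ.1 (toProj q hq) * ψ.1 (toProj q hq)) _ _ =
      φ.1 (toProj q hq) * fractionDeriv q τ (ψ.1 (toProj q hq)) _ _ +
        ψ.1 (toProj q hq) * fractionDeriv q τ (φ.1 (toProj q hq)) _ _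
    have e1 := h1.1
    have e2 := h2.1
    simp only [fractionDeriv, dirDeriv_mul, map_mul, h1.eval_num hqX, h2.eval_num hqX]
    field_simp
    ring
  · ext j
    change D (affineSection X hi j) = τ j
    rw [hD _ (MvPolynomial.X j) (MvPolynomial.X i₀) ⟨by
      rw [MvPolynomial.eval_X, hi]; exact one_ne_zero, fun r hr _ _ => by
      rw [MvPolynomial.eval_X, MvPolynomial.eval_X]
      exact affineCoord_toProj i₀ j r hr⟩]
    -- For `X_j / X_{i₀}` the second term of the quotient rule drops out because `τ i₀ = 0`.
    rw [fractionDeriv, dirDeriv_X, dirDeriv_X, hτi, MvPolynomial.eval_X, hi]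
    simp

/-- The differential of the Gauss map is the second fundamental form. -/
theorem differential_gauss_eq_zero_iff {m : ℕ}
    (hm : IsMorphismAt (projCoords k N) X m (embTangentSpace X) (toProj q hq))
    (t : tangentSpace (projCoords k N) X (toProj q hq))
    (w : embTangentSpace X (toProj q hq)) :
    differential (projCoords k N) X (embTangentSpace X) (toProj q hq) t w = 0 ↔
      ∀ F ∈ homIdeal X, hess q F (coordVec hi t) w = 0 := by
  obtain ⟨w, hw⟩ := w
  obtain ⟨s, U, hU, hqU, hs, rfl⟩ := hm.exists_section hw
  rw [differential_apply hm t s hU hqU hs hw, Submodule.mkQ_apply,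
    Submodule.Quotient.mk_eq_zero,
    show tangentVec t s ∈ embTangentSpace X (toProj q hq) ↔ _ by rw [embTangentSpace_toProj]]
  -- Apply `t` to the identity `∑ ∂_j F(a) s_j(a) = 0`, which holds on `X` near the point. The
  -- derivatives of the coefficients contribute the Hessian.
  have key : ∀ F : homIdeal X, ∑ j, MvPolynomial.eval q (gaussForms X F j) * tangentVec t s j =
      -hess q F.1 (coordVec hi t) fun j => (s j).1 (toProj q hq) := by
    intro F
    let δ : Fin (N + 1) → localFun (projCoords k N) X (toProj q hq) := fun j =>
      ⟨fun a => MvPolynomial.eval (fun j => affineCoord i₀ j a) (gaussForms X F j),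
        eval_mem_localFun (fun j => (affineSection X hi j).2) _⟩
    have h0 : t.1 (∑ j, δ j * s j) = 0 := by
      refine (tangentSpace_congr t (ψ := 0)
        (isOpen_zariski_inter _ hU (isOpen_nonvanishing (MvPolynomial.X i₀)))
        ⟨hqU, mem_chart hi⟩ hm.1 ?_).trans (map_zero t.1)
      rintro a ⟨haX, haU, ha⟩
      have h1 := hs a ⟨haX, haU⟩
      obtain ⟨h, h2⟩ := exists_toProj_affineCoord ha
      rw [← h2, embTangentSpace_toProj, h2] at h1
      have h3 := h1 F
      have h4 : (∑ j, δ j * s j).1 a = ∑ j, (δ j).1 a * (s j).1 a := by simp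
      rw [h4]
      exact h3
    rw [map_sum] at h0
    have hδ : ∀ j, (δ j).1 (toProj q hq) = MvPolynomial.eval q (gaussForms X F j) := fun j => by
      change MvPolynomial.eval (fun j => affineCoord i₀ j (toProj q hq)) _ = _
      rw [show (fun j => affineCoord i₀ j (toProj q hq)) = q from funext (affineCoord_self hi)]
    simp only [tangentSpace_mul, Finset.sum_add_distrib, hδ] at h0
    rw [eq_neg_iff_add_eq_zero, ← h0]
    congr 1
    rw [hess_apply, Finset.sum_comm]
    refine Finset.sum_congr rfl fun j _ => ?_
    rw [show t.1 (δ j) = _ from tangentSpace_affine_eval hi t _, Finset.mul_sum]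
    refine Finset.sum_congr rfl fun i _ => ?_
    simp only [gaussForms]
    ring
  simp only [mem_commonKernel, key, neg_eq_zero, Subtype.forall]

theorem isMorphismAt_submodule (hqX : toProj q hq ∈ X) :
    IsMorphismAt (projCoords k N) X 1 Projectivization.submodule (toProj q hq) := by
  obtain ⟨i₀, hi⟩ := Function.ne_iff.1 hq
  have hi : q i₀ ≠ 0 := hi
  refine ⟨hqX, fun _ a j => affineCoord i₀ j a, ⟨fun _ j => ?_, nonvanishing (MvPolynomial.X i₀),
    isOpen_nonvanishing _, ⟨q, hq, rfl, by rwa [MvPolynomial.eval_X]⟩, ?_⟩⟩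
  · exact mem_localFun_of_eq hq rfl (g := MvPolynomial.X j)
      (d := MvPolynomial.X i₀) (by rwa [MvPolynomial.eval_X])
      fun r hr _ _ => by rw [affineCoord_toProj, MvPolynomial.eval_X, MvPolynomial.eval_X]
  · rintro a ⟨-, ha⟩
    obtain ⟨h, h2⟩ := exists_toProj_affineCoord ha
    refine ⟨LinearIndependent.of_subsingleton 0 h, ?_⟩
    conv_rhs => rw [← h2, Projectivization.submodule_mk]
    rw [Set.range_const]

theorem differential_submodule_apply (hqX : toProj q hq ∈ X)
    (t : tangentSpace (projCoords k N) X (toProj q hq))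
    (hmem : q ∈ (toProj q hq).submodule) :
    differential (projCoords k N) X Projectivization.submodule (toProj q hq) t ⟨q, hmem⟩ =
      (toProj q hq).submodule.mkQ (coordVec hi t) := by
  have h1 : (fun j => affineCoord i₀ j (toProj q hq)) = q := funext (affineCoord_self hi)
  have := differential_apply (isMorphismAt_submodule hqX) t (affineSection X hi)
    (isOpen_nonvanishing (MvPolynomial.X i₀)) (mem_chart hi) (by
      rintro a ⟨-, ha⟩
      obtain ⟨h, h2⟩ := exists_toProj_affineCoord ha
      have h3 : a.submodule = Submodule.span k {fun j => affineCoord i₀ j a} := by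
        conv_lhs => rw [← h2, Projectivization.submodule_mk]
      rw [h3]
      exact Submodule.mem_span_singleton_self _) (by
      change (fun j => affineCoord i₀ j (toProj q hq)) ∈ _
      rwa [h1])
  rw [← this]
  congr 1
  exact Subtype.ext h1.symm

end Chart

/-! ### The radical of the second fundamental form as shrinking map and as degeneracy map -/

section Degeneracy

theorem hess_scalePoly (c : k) (q : Vec k N) (F : MvPolynomial (Fin (N + 1)) k) (v w : Vec k N) :
    hess q (scalePoly c F) v w = c * c * hess (c • q) F v w := by
  simp only [hess_apply, pderiv_scalePoly, MvPolynomial.pderiv_C_mul, map_mul,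
    MvPolynomial.eval_C, eval_scalePoly, Finset.mul_sum]
  exact Finset.sum_congr rfl fun i _ => Finset.sum_congr rfl fun j _ => by ring

variable [PerfectField k] [(homIdeal X).IsPrime] {n : ℕ} (hn : HasDim X n)
include hn

theorem commonKernel_degeneracyForms_smul {q : Vec k N} {hq : q ≠ 0}
    (hx : IsSmoothPoint X n (toProj q hq)) {c : k} (hc : c ≠ 0) :
    commonKernel (MvPolynomial.eval q) (degeneracyForms X) =
      commonKernel (MvPolynomial.eval (c • q)) (degeneracyForms X) := by
  have hx' : IsSmoothPoint X n (toProj (c • q) (smul_ne_zero hc hq)) := by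
    rwa [toProj_smul hq hc]
  ext v
  rw [mem_commonKernel_degeneracyForms hn hx, mem_commonKernel_degeneracyForms hn hx',
    toProj_smul hq hc]
  refine and_congr_right fun _ => forall₂_congr fun w _ => ⟨fun H F hF => ?_, fun H F hF => ?_⟩
  · have := H _ (scalePoly_mem_homIdeal hF c hc)
    rw [hess_scalePoly] at this
    exact (mul_eq_zero.1 this).resolve_left (mul_ne_zero hc hc)
  · have := H _ (scalePoly_mem_homIdeal hF c⁻¹ (inv_ne_zero hc))
    rw [hess_scalePoly, inv_smul_smul₀ hc] at this
    exact (mul_eq_zero.1 this).resolve_left (mul_ne_zero (inv_ne_zero hc) (inv_ne_zero hc))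

variable [Infinite k]

/-- The shrinking condition tests `w` only against tangent vectors with zero `i₀`-th coordinate.
Together with `q` these span the embedded tangent space, and `q` pairs to zero with everything. -/
theorem shrinkingMap_gauss_of_normalized {q : Vec k N} {hq : q ≠ 0} {i₀ : Fin (N + 1)}
    (hi : q i₀ = 1) (hx : IsSmoothPoint X n (toProj q hq)) :
    shrinkingMap (projCoords k N) X (embTangentSpace X) (toProj q hq) =
      commonKernel (MvPolynomial.eval q) (degeneracyForms X) := by
  have hm := hx.isMorphismAt hn
  ext v
  rw [mem_commonKernel_degeneracyForms hn hx, shrinkingMap, Submodule.mem_map]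
  constructor
  · rintro ⟨w, hw, rfl⟩
    refine ⟨w.2, fun u hu F hF => ?_⟩
    obtain ⟨t, ht⟩ := exists_coordVec_eq hi hx.1 (τ := u - u i₀ • q)
      (sub_mem hu (Submodule.smul_mem _ _ (self_mem_embTangentSpace hx.1))) (by simp [hi])
    have h1 : differential (projCoords k N) X (embTangentSpace X) (toProj q hq) t w = 0 :=
      LinearMap.congr_fun (LinearMap.mem_ker.1 hw) t
    have h2 := (differential_gauss_eq_zero_iff hi hm t w).1 h1 F hF
    rw [ht, hess_comm, map_sub, map_smul, hess_self hF w.2, smul_zero, sub_zero] at h2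
    exact h2
  · rintro ⟨hv, H⟩
    refine ⟨⟨v, hv⟩, LinearMap.mem_ker.2 (LinearMap.ext fun t => ?_), rfl⟩
    refine (differential_gauss_eq_zero_iff hi hm t ⟨v, hv⟩).2 fun F hF => ?_
    rw [hess_comm]
    exact H _ (coordVec_mem hi hx.1 t) F hF

/-- A tangent vector is killed by the differential exactly when its `τ` is in the radical. The
radical contains `q`, so it is recovered from these `τ` modulo the line of `q`. -/
theorem degeneracyMap_of_normalized {q : Vec k N} {hq : q ≠ 0} {i₀ : Fin (N + 1)}
    (hi : q i₀ = 1) (hx : IsSmoothPoint X n (toProj q hq)) :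
    degeneracyMap X (toProj q hq) =
      commonKernel (MvPolynomial.eval q) (degeneracyForms X) := by
  have hm := hx.isMorphismAt hn
  have hmem : q ∈ (toProj q hq).submodule := by
    rw [Projectivization.submodule_mk]
    exact Submodule.mem_span_singleton_self _
  have hqT := self_mem_embTangentSpace (X := X) (hq := hq) hx.1
  have hqD : q ∈ commonKernel (MvPolynomial.eval q) (degeneracyForms X) := by
    rw [mem_commonKernel_degeneracyForms hn hx]
    exact ⟨hqT, fun w hw F hF => by rw [hess_comm, hess_self hF hw]⟩
  have hK : ∀ t, t ∈ LinearMap.ker (differential (projCoords k N) X (embTangentSpace X)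
      (toProj q hq)) ↔ coordVec hi t ∈ commonKernel (MvPolynomial.eval q) (degeneracyForms X) := by
    intro t
    rw [mem_commonKernel_degeneracyForms hn hx, and_iff_right (coordVec_mem hi hx.1 t),
      LinearMap.mem_ker]
    constructor
    · intro h w hw F hF
      exact (differential_gauss_eq_zero_iff hi hm t ⟨w, hw⟩).1 (by rw [h]; rfl) F hF
    · intro h
      ext1 w
      exact (differential_gauss_eq_zero_iff hi hm t w).2 fun F hF => h w w.2 F hF
  apply le_antisymm
  · intro v hv
    have hle : (⨆ t ∈ LinearMap.ker (differential (projCoords k N) X (embTangentSpace X)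
        (toProj q hq)), LinearMap.range (differential (projCoords k N) X
          Projectivization.submodule (toProj q hq) t)) ≤
        (commonKernel (MvPolynomial.eval q) (degeneracyForms X)).map
          (toProj q hq).submodule.mkQ := by
      refine iSup₂_le fun t ht => ?_
      rintro _ ⟨⟨u, hu⟩, rfl⟩
      have hu' := hu
      rw [Projectivization.submodule_mk, Submodule.mem_span_singleton] at hu'
      obtain ⟨c, rfl⟩ := hu'
      refine ⟨c • coordVec hi t, Submodule.smul_mem _ _ ((hK t).1 ht), ?_⟩
      rw [map_smul, ← differential_submodule_apply hi hx.1 t hmem, ← map_smul]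
      rfl
    obtain ⟨w, hw, hwv⟩ := hle hv
    rw [← sub_eq_zero, ← map_sub, Submodule.mkQ_apply, Submodule.Quotient.mk_eq_zero,
      Projectivization.submodule_mk, Submodule.mem_span_singleton] at hwv
    obtain ⟨c, hc⟩ := hwv
    have : v = w - c • q := by rw [hc]; abel
    rw [this]
    exact sub_mem hw (Submodule.smul_mem _ _ hqD)
  · intro v hv
    have hτD : v - v i₀ • q ∈ commonKernel (MvPolynomial.eval q) (degeneracyForms X) :=
      sub_mem hv (Submodule.smul_mem _ _ hqD)
    obtain ⟨t, ht⟩ := exists_coordVec_eq hi hx.1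
      ((mem_commonKernel_degeneracyForms hn hx).1 hτD).1 (by simp [hi])
    refine Submodule.mem_comap.2 ?_
    have h1 : (toProj q hq).submodule.mkQ v = (toProj q hq).submodule.mkQ (coordVec hi t) := by
      rw [ht, map_sub, map_smul, show (toProj q hq).submodule.mkQ q = 0 from
        (Submodule.Quotient.mk_eq_zero _).2 hmem, smul_zero, sub_zero]
    rw [h1, ← differential_submodule_apply hi hx.1 t hmem]
    exact Submodule.mem_iSup_of_mem t (Submodule.mem_iSup_of_mem ((hK t).2 (by rwa [ht])) ⟨_, rfl⟩)

/-- At smooth points, the shrinking map of the Gauss map is the kernel of the second fundamental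
form. -/
theorem shrinkingMap_gauss {q : Vec k N} {hq : q ≠ 0} (hx : IsSmoothPoint X n (toProj q hq)) :
    shrinkingMap (projCoords k N) X (embTangentSpace X) (toProj q hq) =
      commonKernel (MvPolynomial.eval q) (degeneracyForms X) := by
  obtain ⟨p, hp, i₀, hi, hpq⟩ := exists_normalized_rep (toProj q hq)
  obtain ⟨c, hc, rfl⟩ := exists_smul_of_toProj_eq hpq
  rw [commonKernel_degeneracyForms_smul hn hx hc]
  rw [← hpq] at hx ⊢
  rw [shrinkingMap_gauss_of_normalized hn hi hx]

/-- At smooth points, the degeneracy map is the kernel of the second fundamental form. -/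
theorem degeneracyMap_eq {q : Vec k N} {hq : q ≠ 0} (hx : IsSmoothPoint X n (toProj q hq)) :
    degeneracyMap X (toProj q hq) =
      commonKernel (MvPolynomial.eval q) (degeneracyForms X) := by
  obtain ⟨p, hp, i₀, hi, hpq⟩ := exists_normalized_rep (toProj q hq)
  obtain ⟨c, hc, rfl⟩ := exists_smul_of_toProj_eq hpq
  rw [commonKernel_degeneracyForms_smul hn hx hc]
  rw [← hpq] at hx ⊢
  rw [degeneracyMap_of_normalized hn hi hx]

end Degeneracy

end SecondForm

variable {k : Type*} [Field k] {N : ℕ} {X : Set (ℙ k (Vec k N))}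

/-! ### The graph of the Gauss map -/

/-- Coordinates on the product of the Grassmannian and projective space. -/
abbrev graphCoords (k : Type*) [Field k] (N n : ℕ) : HomCoords k (Gr k N (n + 1) × ℙ k (Vec k N)) :=
  (grCoords k N (n + 1)).prod (projCoords k N)

/-- The index set of the coordinates on the product. -/
abbrev GraphIdx (N n : ℕ) : Type := (Fin (n + 1) × Fin (N + 1)) ⊕ Fin (N + 1)

variable {n : ℕ}

/-- The point with coordinates `p`. -/
def graphProj (p : GraphIdx N n → k)
    (hb : LinearIndependent k fun (i : Fin (n + 1)) (j : Fin (N + 1)) => p (Sum.inl (i, j)))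
    (hq : (fun j => p (Sum.inr j)) ≠ 0) : Gr k N (n + 1) × ℙ k (Vec k N) :=
  (graphCoords k N n).proj ⟨p, hb, hq⟩

theorem graphProj_fst (p : GraphIdx N n → k) (hb hq) : (graphProj p hb hq).1.1 =
    Submodule.span k (Set.range fun (i : Fin (n + 1)) (j : Fin (N + 1)) => p (Sum.inl (i, j))) :=
  rfl

theorem graphProj_snd (p : GraphIdx N n → k) (hb hq) : (graphProj p hb hq).2 =
    toProj (fun j => p (Sum.inr j)) hq :=
  rfl

theorem isOpen_graph_iff {U : Set (Gr k N (n + 1) × ℙ k (Vec k N))} :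
    IsOpen[(graphCoords k N n).zariski] U ↔ ∀ (p : GraphIdx N n → k) (hb hq),
      graphProj p hb hq ∈ U → ∃ f : MvPolynomial (GraphIdx N n) k,
        MvPolynomial.eval p f ≠ 0 ∧ ∀ (r : GraphIdx N n → k) (hb hq),
          MvPolynomial.eval r f ≠ 0 → graphProj r hb hq ∈ U :=
  (isOpen_zariski_iff _).trans
    ⟨fun h p hb hq hU => let ⟨f, hf, H⟩ := h ⟨p, hb, hq⟩ hU
      ⟨f, hf, fun r hb hq => H ⟨r, hb, hq⟩⟩,
      fun h p hU => let ⟨f, hf, H⟩ := h p.1 p.2.1 p.2.2 hU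
      ⟨f, hf, fun r => H r.1 r.2.1 r.2.2⟩⟩

theorem isRegularFun_graph_iff {Z : Set (Gr k N (n + 1) × ℙ k (Vec k N))} {z}
    {φ : Gr k N (n + 1) × ℙ k (Vec k N) → k} :
    φ ∈ localFun (graphCoords k N n) Z z ↔ ∀ (p : GraphIdx N n → k) (hb hq),
      graphProj p hb hq = z → ∃ g h : MvPolynomial (GraphIdx N n) k,
        MvPolynomial.eval p h ≠ 0 ∧ ∀ (r : GraphIdx N n → k) (hb hq),
          graphProj r hb hq ∈ Z → MvPolynomial.eval r h ≠ 0 →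
            φ (graphProj r hb hq) = MvPolynomial.eval r g / MvPolynomial.eval r h :=
  ⟨fun h p hb hq hU => let ⟨g, d, hd, H⟩ := h ⟨p, hb, hq⟩ hU
    ⟨g, d, hd, fun r hb hq => H ⟨r, hb, hq⟩⟩,
    fun h p hU => let ⟨g, d, hd, H⟩ := h p.1 p.2.1 p.2.2 hU
    ⟨g, d, hd, fun r => H r.1 r.2.1 r.2.2⟩⟩

theorem eval_rename_inr (p : GraphIdx N n → k) (f : MvPolynomial (Fin (N + 1)) k) :
    MvPolynomial.eval p (MvPolynomial.rename Sum.inr f) =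
      MvPolynomial.eval (fun j => p (Sum.inr j)) f := by
  rw [MvPolynomial.eval_rename]
  rfl

theorem isOpen_preimage_snd {U : Set (ℙ k (Vec k N))} (hU : IsOpen[(projCoords k N).zariski] U) :
    IsOpen[(graphCoords k N n).zariski] {y | y.2 ∈ U} := by
  rw [isOpen_graph_iff]
  intro p hb hq hp
  obtain ⟨f, hf, H⟩ := isOpen_proj_iff.1 hU _ hq hp
  refine ⟨MvPolynomial.rename Sum.inr f, by rwa [eval_rename_inr], fun r _ hr hne => ?_⟩
  rw [eval_rename_inr] at hne
  exact H _ hr hne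

/-- Inclusion, unlike equality, is given everywhere by polynomial equations: each differential of an
equation of `X` at the point annihilates each row of the matrix. -/
theorem isClosed_le_embTangentSpace (X : Set (ℙ k (Vec k N))) (n : ℕ) :
    IsClosed[(graphCoords k N n).zariski] {y | y.1.1 ≤ embTangentSpace X y.2} := by
  refine isClosed_zariski_of_forall (graphCoords k N n) (S := homIdeal X × Fin (n + 1))
    (fun s => (∑ j, MvPolynomial.rename Sum.inr (gaussForms X s.1 j) *
      MvPolynomial.X (Sum.inl (s.2, j)) : MvPolynomial (GraphIdx N n) k)) ?_
  suffices h : ∀ (p : GraphIdx N n → k) (hb hq),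
      (graphProj p hb hq).1.1 ≤ embTangentSpace X (graphProj p hb hq).2 ↔
    ∀ s : homIdeal X × Fin (n + 1), MvPolynomial.eval p
      (∑ j, MvPolynomial.rename Sum.inr (gaussForms X s.1 j) *
        MvPolynomial.X (Sum.inl (s.2, j)) : MvPolynomial (GraphIdx N n) k) = 0 from
    fun p => h p.1 p.2.1 p.2.2
  intro p hb hq
  rw [graphProj_fst, graphProj_snd, embTangentSpace_toProj, Submodule.span_le]
  simp only [map_sum, map_mul, eval_rename_inr, MvPolynomial.eval_X]
  constructor
  · rintro H ⟨F, i⟩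
    exact H ⟨i, rfl⟩ F
  · rintro H _ ⟨i, rfl⟩ F
    exact H (F, i)

theorem gaussGraph_subset (hX : IsClosed[(projCoords k N).zariski] X) :
    ∀ y ∈ gaussGraph X n, y.2 ∈ X ∧ y.1.1 ≤ embTangentSpace X y.2 := by
  let _ := (graphCoords k N n).zariski
  have h1 : IsClosed {y : Gr k N (n + 1) × ℙ k (Vec k N) | y.2 ∈ X} := by
    rw [← isOpen_compl_iff]
    exact isOpen_preimage_snd (@IsClosed.isOpen_compl _ (projCoords k N).zariski _ hX)
  have h2 := h1.inter (isClosed_le_embTangentSpace X n)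
  have h3 : {y : Gr k N (n + 1) × ℙ k (Vec k N) | IsSmoothPoint X n y.2 ∧
      y.1.1 = embTangentSpace X y.2} ⊆
      {y | y.2 ∈ X} ∩ {y | y.1.1 ≤ embTangentSpace X y.2} := fun y hy => ⟨hy.1.1, hy.2.le⟩
  exact fun y hy => closure_minimal h3 h2 hy

/-- The point of the graph of the Gauss map over a smooth point. -/
def gaussPoint {x : ℙ k (Vec k N)} (hx : IsSmoothPoint X n x) : Gr k N (n + 1) × ℙ k (Vec k N) :=
  (⟨embTangentSpace X x, hx.2⟩, x)

theorem gaussPoint_mem {x : ℙ k (Vec k N)} (hx : IsSmoothPoint X n x) :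
    gaussPoint hx ∈ gaussGraph X n :=
  @subset_closure _ (graphCoords k N n).zariski _ _ ⟨hx, rfl⟩

/-- Over a smooth point the closed inclusion condition is between spaces of dimension `n + 1`, hence
an equality. The closure adds no points there. -/
theorem eq_gaussPoint (hX : IsClosed[(projCoords k N).zariski] X)
    {y : Gr k N (n + 1) × ℙ k (Vec k N)} (hy : y ∈ gaussGraph X n)
    (hx : IsSmoothPoint X n y.2) : y = gaussPoint hx := by
  refine Prod.ext (Subtype.ext ?_) rfl
  exact Submodule.eq_of_le_of_finrank_eq (gaussGraph_subset hX y hy).2 (y.1.2.trans hx.2.symm)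

theorem comp_snd_mem_localFun (hX : IsClosed[(projCoords k N).zariski] X)
    {z : Gr k N (n + 1) × ℙ k (Vec k N)} {φ : ℙ k (Vec k N) → k}
    (hφ : φ ∈ localFun (projCoords k N) X z.2) :
    (fun y => φ y.2) ∈ localFun (graphCoords k N n) (gaussGraph X n) z := by
  rw [isRegularFun_graph_iff]
  rintro p hb hq rfl
  obtain ⟨g, h, hh, H⟩ := exists_eq_of_mem_localFun hq hφ
  refine ⟨MvPolynomial.rename Sum.inr g, MvPolynomial.rename Sum.inr h,
    by rwa [eval_rename_inr], fun r hb' hr hrZ hne => ?_⟩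
  rw [eval_rename_inr] at hne
  rw [eval_rename_inr, eval_rename_inr]
  exact H _ hr (gaussGraph_subset hX _ hrZ).1 hne

/-- A morphism on `X` pulls back to a morphism on the graph. -/
theorem IsMorphismAt.comp_snd (hX : IsClosed[(projCoords k N).zariski] X)
    {x : ℙ k (Vec k N)} (hx : IsSmoothPoint X n x) {m : ℕ}
    {f : ℙ k (Vec k N) → Submodule k (Vec k N)} (hf : IsMorphismAt (projCoords k N) X m f x)
    {g : Gr k N (n + 1) × ℙ k (Vec k N) → Submodule k (Vec k N)} {U : Set (ℙ k (Vec k N))}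
    (hU : IsOpen[(projCoords k N).zariski] U) (hxU : x ∈ U)
    (hg : ∀ y ∈ gaussGraph X n, y.2 ∈ U → g y = f y.2) :
    IsMorphismAt (graphCoords k N n) (gaussGraph X n) m g (gaussPoint hx) := by
  obtain ⟨-, e, he⟩ := hf
  obtain ⟨V, hV, hxV, H⟩ := he.basis
  refine ⟨gaussPoint_mem hx, fun i y => e i y.2,
    fun i j => comp_snd_mem_localFun hX (z := gaussPoint hx) (he.regular i j),
    {y | y.2 ∈ U ∩ V}, isOpen_preimage_snd (isOpen_zariski_inter _ hU hV), ⟨hxU, hxV⟩, ?_⟩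
  rintro y ⟨hyZ, hyU, hyV⟩
  rw [hg y hyZ hyU]
  exact H y.2 ⟨(gaussGraph_subset hX y hyZ).1, hyV⟩

/-! ### Tangent vectors and shrinking maps: comparing the graph with `X` -/

section GraphPoints

variable [PerfectField k] [(homIdeal X).IsPrime] (hn : HasDim X n)
include hn

theorem isMorphismAt_fst (hX : IsClosed[(projCoords k N).zariski] X)
    {x : ℙ k (Vec k N)} (hx : IsSmoothPoint X n x) :
    IsMorphismAt (graphCoords k N n) (gaussGraph X n) (n + 1) (fun y => y.1.1) (gaussPoint hx) := by
  obtain ⟨U, hU, hxU, H⟩ := hx.exists_isOpen hn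
  refine (hx.isMorphismAt hn).comp_snd hX hx hU hxU fun y hy hyU => ?_
  have hy2 := H y.2 ⟨(gaussGraph_subset hX y hy).1, hyU⟩
  exact congrArg (fun y => y.1.1) (eq_gaussPoint hX hy hy2)

/-- The Gauss map lifts locally to homogeneous coordinates of its graph. -/
theorem exists_graph_lift {x : ℙ k (Vec k N)} (hx : IsSmoothPoint X n x) :
    ∃ φ : GraphIdx N n → localFun (projCoords k N) X x, ∃ U : Set (ℙ k (Vec k N)),
      IsOpen[(projCoords k N).zariski] U ∧ x ∈ U ∧ ∀ a ∈ X ∩ U,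
        ∃ ha : IsSmoothPoint X n a, ∃ hb hq,
          graphProj (fun i => (φ i).1 a) hb hq = gaussPoint ha := by
  obtain ⟨q, hq, i₀, hi, rfl⟩ := exists_normalized_rep x
  obtain ⟨-, e, he⟩ := hx.isMorphismAt hn
  obtain ⟨V, hV, hxV, H⟩ := he.basis
  refine ⟨Sum.elim (fun p => ⟨fun a => e p.1 a p.2, he.regular p.1 p.2⟩) (affineSection X hi),
    V ∩ nonvanishing (MvPolynomial.X i₀), isOpen_zariski_inter _ hV (isOpen_nonvanishing _),
    ⟨hxV, mem_chart hi⟩, ?_⟩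
  rintro a ⟨haX, haV, ha⟩
  obtain ⟨h, h2⟩ := exists_toProj_affineCoord ha
  have haS : IsSmoothPoint X n a := by
    refine ⟨haX, ?_⟩
    rw [← (H a ⟨haX, haV⟩).2, finrank_span_eq_card (H a ⟨haX, haV⟩).1, Fintype.card_fin]
  exact ⟨haS, (H a ⟨haX, haV⟩).1, h, Prod.ext (Subtype.ext (H a ⟨haX, haV⟩).2) h2⟩

/-- The Gauss map is continuous at smooth points. -/
theorem exists_isOpen_gaussPoint_mem {x : ℙ k (Vec k N)} (hx : IsSmoothPoint X n x)
    {O : Set (Gr k N (n + 1) × ℙ k (Vec k N))} (hO : IsOpen[(graphCoords k N n).zariski] O)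
    (hxO : gaussPoint hx ∈ O) : ∃ U : Set (ℙ k (Vec k N)),
      IsOpen[(projCoords k N).zariski] U ∧ x ∈ U ∧ ∀ a ∈ X ∩ U,
        ∃ ha : IsSmoothPoint X n a, gaussPoint ha ∈ O := by
  obtain ⟨φ, U, hU, hxU, H⟩ := exists_graph_lift hn hx
  obtain ⟨_, hb, hq, hxp⟩ := H x ⟨hx.1, hxU⟩
  obtain ⟨f, hf, Hf⟩ := isOpen_graph_iff.1 hO (fun i => (φ i).1 x) hb hq
    (by rw [hxp]; exact hxO)
  obtain ⟨V, hV, hxV, HV⟩ := exists_isOpen_ne_zero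
    (eval_mem_localFun (fun i => (φ i).2) f) hx.1 hf
  refine ⟨U ∩ V, isOpen_zariski_inter _ hU hV, ⟨hxU, hxV⟩, ?_⟩
  rintro a ⟨haX, haU, haV⟩
  obtain ⟨ha, hb', hq', hap⟩ := H a ⟨haX, haU⟩
  have h1 := Hf (fun i => (φ i).1 a) hb' hq' (HV a ⟨haX, haV⟩)
  rw [hap] at h1
  exact ⟨ha, h1⟩

open Classical in
/-- The graph morphism, extended by a constant. -/
def gaussLift {x : ℙ k (Vec k N)} (hx : IsSmoothPoint X n x) (a : ℙ k (Vec k N)) :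
    Gr k N (n + 1) × ℙ k (Vec k N) :=
  if ha : IsSmoothPoint X n a then gaussPoint ha else gaussPoint hx

theorem comp_gaussLift_mem_localFun {x : ℙ k (Vec k N)} (hx : IsSmoothPoint X n x)
    {ψ : Gr k N (n + 1) × ℙ k (Vec k N) → k}
    (hψ : ψ ∈ localFun (graphCoords k N n) (gaussGraph X n) (gaussPoint hx)) :
    (fun a => ψ (gaussLift hx a)) ∈ localFun (projCoords k N) X x := by
  obtain ⟨φ, U, hU, hxU, H⟩ := exists_graph_lift hn hx
  obtain ⟨_, hb, hq, hxp⟩ := H x ⟨hx.1, hxU⟩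
  obtain ⟨g, d, hd, Hd⟩ := isRegularFun_graph_iff.1 hψ _ hb hq hxp
  have hmem := fun f => eval_mem_localFun (fun i => (φ i).2) f
  obtain ⟨V, hV, hxV, HV⟩ := exists_isOpen_ne_zero (hmem d) hx.1 hd
  refine localFun_congr (mul_mem (hmem g) (localFun_inv (hmem d) hx.1 hd))
    (isOpen_zariski_inter _ hU hV) ⟨hxU, hxV⟩ ?_
  rintro a ⟨haX, haU, haV⟩
  obtain ⟨ha, hb, hq, hap⟩ := H a ⟨haX, haU⟩
  have h1 := Hd _ hb hq (by rw [hap]; exact gaussPoint_mem ha) (HV a ⟨haX, haV⟩)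
  rw [gaussLift, dif_pos ha, ← hap, h1, div_eq_mul_inv]
  rfl

/-- The differential of the projection of the graph to `X`. -/
def pushforward (hX : IsClosed[(projCoords k N).zariski] X) {x : ℙ k (Vec k N)}
    (hx : IsSmoothPoint X n x)
    (t : tangentSpace (graphCoords k N n) (gaussGraph X n) (gaussPoint hx)) :
    tangentSpace (projCoords k N) X x :=
  ⟨{  toFun := fun φ => t.1 ⟨fun y => φ.1 y.2, comp_snd_mem_localFun hX φ.2⟩
      map_add' := fun φ ψ => map_add t.1 ⟨fun y => φ.1 y.2, comp_snd_mem_localFun hX φ.2⟩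
        ⟨fun y => ψ.1 y.2, comp_snd_mem_localFun hX ψ.2⟩
      map_smul' := fun c φ => map_smul t.1 c ⟨fun y => φ.1 y.2, comp_snd_mem_localFun hX φ.2⟩ },
    fun φ ψ => t.2 ⟨fun y => φ.1 y.2, comp_snd_mem_localFun hX φ.2⟩
      ⟨fun y => ψ.1 y.2, comp_snd_mem_localFun hX ψ.2⟩⟩

/-- Pushing forward along `(γ, id)` gives a right inverse, since `pr₂ ∘ (γ, id)` is the identity
near `x`. Surjectivity suffices for comparing the kernels. -/
theorem pushforward_surjective (hX : IsClosed[(projCoords k N).zariski] X) {x : ℙ k (Vec k N)}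
    (hx : IsSmoothPoint X n x) : Function.Surjective (pushforward hX hx) := by
  intro t
  have hm := fun (ψ : localFun (graphCoords k N n) (gaussGraph X n) (gaussPoint hx)) =>
    comp_gaussLift_mem_localFun hn hx ψ.2
  have hxx : gaussLift hx x = gaussPoint hx := dif_pos hx
  refine ⟨⟨{  toFun := fun ψ => t.1 ⟨fun a => ψ.1 (gaussLift hx a), hm ψ⟩
              map_add' := fun φ ψ => map_add t.1 ⟨fun a => φ.1 (gaussLift hx a), hm φ⟩
                ⟨fun a => ψ.1 (gaussLift hx a), hm ψ⟩
              map_smul' := fun c ψ => map_smul t.1 c ⟨fun a => ψ.1 (gaussLift hx a), hm ψ⟩ },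
    fun φ ψ => ?_⟩, ?_⟩
  · have := tangentSpace_mul t ⟨fun a => φ.1 (gaussLift hx a), hm φ⟩
      ⟨fun a => ψ.1 (gaussLift hx a), hm ψ⟩
    refine this.trans ?_
    change φ.1 (gaussLift hx x) * _ + ψ.1 (gaussLift hx x) * _ = _
    rw [hxx]
    rfl
  · obtain ⟨U, hU, hxU, H⟩ := hx.exists_isOpen hn
    apply Subtype.ext
    ext φ
    change t.1 ⟨fun a => φ.1 (gaussLift hx a).2, _⟩ = t.1 φ
    refine tangentSpace_congr t hU hxU hx.1 fun a ha => ?_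
    change φ.1 (gaussLift hx a).2 = φ.1 a
    rw [gaussLift, dif_pos (H a ha)]
    rfl

/-- A local section of the Gauss bundle pulls back along `pr₂` to a section for `pr₁`, and both
differentials can be computed with it. -/
theorem differential_fst (hX : IsClosed[(projCoords k N).zariski] X) {x : ℙ k (Vec k N)}
    (hx : IsSmoothPoint X n x)
    (t : tangentSpace (graphCoords k N n) (gaussGraph X n) (gaussPoint hx))
    (w : embTangentSpace X x) :
    differential (graphCoords k N n) (gaussGraph X n) (fun y => y.1.1) (gaussPoint hx) t w =
      differential (projCoords k N) X (embTangentSpace X) x (pushforward hX hx t) w := by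
  obtain ⟨w, hw⟩ := w
  have hm := hx.isMorphismAt hn
  obtain ⟨s, U, hU, hxU, hs, rfl⟩ := hm.exists_section hw
  rw [differential_apply hm _ s hU hxU hs hw]
  exact differential_apply (isMorphismAt_fst hn hX hx) t
    (fun j => ⟨fun y => (s j).1 y.2, comp_snd_mem_localFun hX (s j).2⟩)
    (isOpen_preimage_snd (isOpen_zariski_inter _ hU (hx.exists_isOpen hn).choose_spec.1))
    ⟨hxU, (hx.exists_isOpen hn).choose_spec.2.1⟩ (by
      rintro y ⟨hyZ, hyU, hyV⟩
      have hyX := (gaussGraph_subset hX y hyZ).1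
      have hy2 := (hx.exists_isOpen hn).choose_spec.2.2 y.2 ⟨hyX, hyV⟩
      rw [show y.1.1 = embTangentSpace X y.2 from
        congrArg (fun y => y.1.1) (eq_gaussPoint hX hyZ hy2)]
      exact hs y.2 ⟨hyX, hyU⟩) hw

/-- The shrinking map of the graph with respect to the first projection is the shrinking map of
the Gauss map. -/
theorem shrinkingMap_fst (hX : IsClosed[(projCoords k N).zariski] X) {x : ℙ k (Vec k N)}
    (hx : IsSmoothPoint X n x) :
    shrinkingMap (graphCoords k N n) (gaussGraph X n) (fun y => y.1.1) (gaussPoint hx) =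
      shrinkingMap (projCoords k N) X (embTangentSpace X) x := by
  ext v
  simp only [shrinkingMap, Submodule.mem_map]
  constructor
  · rintro ⟨w, hw, rfl⟩
    refine ⟨w, LinearMap.mem_ker.2 (LinearMap.ext fun t => ?_), rfl⟩
    obtain ⟨t, rfl⟩ := pushforward_surjective hn hX hx t
    exact (differential_fst hn hX hx t w).symm.trans
      (LinearMap.congr_fun (LinearMap.mem_ker.1 hw) t)
  · rintro ⟨w, hw, rfl⟩
    refine ⟨w, LinearMap.mem_ker.2 (LinearMap.ext fun t => ?_), rfl⟩
    exact (differential_fst hn hX hx t w).trans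
      (LinearMap.congr_fun (LinearMap.mem_ker.1 hw) (pushforward hX hx t))

/-- A neighbourhood of a Gauss point pulls back by continuity of `γ` to an open set of `X`, which
meets `U` by irreducibility of `X`. The Gauss points are dense in the graph by construction. -/
theorem gaussGraph_subset_closure (hX : @IsIrreducible _ (projCoords k N).zariski X)
    {U : Set (ℙ k (Vec k N))} (hU : IsOpen[(projCoords k N).zariski] U) (hne : (X ∩ U).Nonempty) :
    gaussGraph X n ⊆ closure[(graphCoords k N n).zariski] (gaussGraph X n ∩ {y | y.2 ∈ U}) := by
  let _ := (graphCoords k N n).zariski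
  refine closure_minimal ?_ isClosed_closure
  rintro y ⟨hy, hy1⟩
  have hyp : y = gaussPoint hy := Prod.ext (Subtype.ext hy1) rfl
  rw [mem_closure_iff]
  intro O hO hyO
  rw [hyp] at hyO
  obtain ⟨V, hV, hyV, H⟩ := exists_isOpen_gaussPoint_mem hn hy hO hyO
  obtain ⟨a, haX, haV, haU⟩ := hX.2 V U hV hU ⟨y.2, hy.1, hyV⟩ hne
  obtain ⟨ha, haO⟩ := H a ⟨haX, haV⟩
  exact ⟨gaussPoint ha, haO, gaussPoint_mem ha, haU⟩

end GraphPoints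

end GaussShrink

end

/-! ### Coincidence of the three rational maps -/

theorem mainTheorem6 {k : Type*} [Field k] [IsAlgClosed k] (N n : ℕ)
    (X : Set (ℙ k (Vec k N))) (hX : IsProjectiveVariety X) (hn : HasDim X n) :
    -- the Gauss map is a rational map to the Grassmann variety of `n`-planes
    Generically (projCoords k N) X (fun x => IsSmoothPoint X n x ∧
      IsMorphismAt (projCoords k N) X (n + 1) (embTangentSpace X) x) ∧
    ∃ m : ℕ,
      -- the degeneracy map and the two shrinking maps are rational maps to the same Grassmannian
      IsRationalMap (projCoords k N) X m (degeneracyMap X) ∧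
      IsRationalMap (projCoords k N) X m
        (shrinkingMap (projCoords k N) X (embTangentSpace X)) ∧
      IsRationalMap ((grCoords k N (n + 1)).prod (projCoords k N)) (gaussGraph X n) m
        (shrinkingMap ((grCoords k N (n + 1)).prod (projCoords k N)) (gaussGraph X n)
          (fun y => y.1.1)) ∧
      -- `(γ, id)` maps a general point into the domain of the third one, and all three agree
      Generically (projCoords k N) X (fun x =>
        ∃ hx : IsSmoothPoint X n x,
          IsMorphismAt ((grCoords k N (n + 1)).prod (projCoords k N)) (gaussGraph X n) m
            (shrinkingMap ((grCoords k N (n + 1)).prod (projCoords k N)) (gaussGraph X n)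
              (fun y => y.1.1)) (⟨embTangentSpace X x, hx.2⟩, x) ∧
          degeneracyMap X x = shrinkingMap (projCoords k N) X (embTangentSpace X) x ∧
          shrinkingMap (projCoords k N) X (embTangentSpace X) x =
            shrinkingMap ((grCoords k N (n + 1)).prod (projCoords k N)) (gaussGraph X n)
              (fun y => y.1.1) (⟨embTangentSpace X x, hx.2⟩, x)) := by
  have hprime := homIdeal_isPrime hX.2
  obtain ⟨U₀, hU₀, hne₀, hS⟩ := exists_isOpen_isSmoothPoint hX.2 hn
  have hshr : ∀ (q : Vec k N) (hq : q ≠ 0), toProj q hq ∈ X ∩ U₀ →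
      shrinkingMap (projCoords k N) X (embTangentSpace X) (toProj q hq) =
        commonKernel (MvPolynomial.eval q) (degeneracyForms X) :=
    fun q hq h => shrinkingMap_gauss hn (hS _ h)
  have hdeg : ∀ (q : Vec k N) (hq : q ≠ 0), toProj q hq ∈ X ∩ U₀ →
      degeneracyMap X (toProj q hq) =
        commonKernel (MvPolynomial.eval q) (degeneracyForms X) :=
    fun q hq h => degeneracyMap_eq hn (hS _ h)
  have heq : ∀ z ∈ X ∩ U₀,
      degeneracyMap X z = shrinkingMap (projCoords k N) X (embTangentSpace X) z := by
    intro z hz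
    rw [← toProj_rep z] at hz ⊢
    rw [hshr _ _ hz, hdeg _ _ hz]
  -- On `U` the radical has its generic dimension, and this number fixes the Grassmannian for all
  -- three maps.
  obtain ⟨U, hU, hne, hUU₀, hfin⟩ :=
    exists_isOpen_finrank_eq (degeneracyForms X) hU₀ hX.2 hne₀ hshr
  have hmor : ∀ z ∈ X ∩ U, IsMorphismAt (projCoords k N) X
      (genericNullity (homIdeal X) (degeneracyForms X))
      (shrinkingMap (projCoords k N) X (embTangentSpace X)) z := fun z hz =>
    isMorphismAt_of_commonKernel (degeneracyForms X) hU₀ hshr rfl ⟨hz.1, hUU₀ hz.2⟩ (hfin z hz)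
  have hdense := dense_of_isIrreducible _ hX.2 hU hne
  have hmor' : ∀ (x : ℙ k (Vec k N)) (hx : IsSmoothPoint X n x), x ∈ U →
      IsMorphismAt (graphCoords k N n) (gaussGraph X n)
        (genericNullity (homIdeal X) (degeneracyForms X))
        (shrinkingMap (graphCoords k N n) (gaussGraph X n) (fun y => y.1.1)) (gaussPoint hx) := by
    intro x hx hxU
    -- Over `U` the shrinking map of the graph is the pullback along `pr₂` of the one on `X`, so it
    -- inherits its frames.
    refine (hmor x ⟨hx.1, hxU⟩).comp_snd hX.1 hx hU hxU fun y hy hyU => ?_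
    have hy2 := hS y.2 ⟨(gaussGraph_subset hX.1 y hy).1, hUU₀ hyU⟩
    rw [eq_gaussPoint hX.1 hy hy2]
    exact shrinkingMap_fst hn hX.1 hy2
  refine ⟨⟨U₀, hU₀, dense_of_isIrreducible _ hX.2 hU₀ hne₀,
    fun z hz => ⟨hS z hz, (hS z hz).isMorphismAt hn⟩⟩,
    genericNullity (homIdeal X) (degeneracyForms X), ⟨U, hU, hdense, fun z hz => ?_⟩,
    ⟨U, hU, hdense, hmor⟩, ⟨_, isOpen_preimage_snd hU, gaussGraph_subset_closure hn hX.2 hU hne,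
      ?_⟩, ⟨U, hU, hdense, fun z hz => ?_⟩⟩
  · refine isMorphismAt_of_commonKernel (degeneracyForms X) hU₀ hdeg rfl ⟨hz.1, hUU₀ hz.2⟩ ?_
    rw [heq z ⟨hz.1, hUU₀ hz.2⟩, hfin z hz]
  · rintro y ⟨hyZ, hyU⟩
    have hy2 := hS y.2 ⟨(gaussGraph_subset hX.1 y hyZ).1, hUU₀ hyU⟩
    rw [eq_gaussPoint hX.1 hyZ hy2]
    exact hmor' y.2 hy2 hyU
  · have hz2 := hS z ⟨hz.1, hUU₀ hz.2⟩
    exact ⟨hz2, hmor' z hz2 hz.2, heq z ⟨hz.1, hUU₀ hz.2⟩, (shrinkingMap_fst hn hX.1 hz2).symm⟩
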